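/- All graphs are finite, non-empty, simple and undirected, and $[k]=\{1,\dots,k\}$. A $k$-labeled graph is a graph $H$ with a labeling $\mathrm{lab}\colon V(H)\to[k]$. A fuse-$k$-expression is a (finite) parse tree over the following operations on $k$-labeled graphs: introduce a single vertex with label $i\in[k]$; disjoint union; join $\eta_{i,j}$ ($i\ne j$), which adds all edges between vertices of label $i$ and vertices of label $j$; relabel $\rho_{i\to j}$ ($i\neq j$), which changes every label $i$ into $j$; and fuse $\theta_i$ (allowed only if label $i$ occurs), which replaces all vertices of label $i$ by a single vertex of label $i$ adjacent to exactly those remaining vertices that were adjacent to at least one of the replaced vertices. A multi-$k$-labeled graph is a graph $H$ with a multi-labeling $\mathrm{lab}\colon V(H)\to 2^{[k]}$. A multi-$k$-expression is a parse tree over the following operations on multi-$k$-labeled graphs: introduce a single vertex with a non-empty label set $S\subseteq[k]$; disjoint union; join $\eta_{i,j}$ ($i\neq j$, allowed only if no vertex holds both labels $i$ and $j$), which adds all edges between vertices holding label $i$ and vertices holding label $j$; and relabel $\rho_{i\to S}$ ($i\in[k]$, $S\subseteq[k]$, possibly $S=\emptyset$), which replaces every label set $L$ with $i\in L$ by $(L\setminus\{i\})\cup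 S$. An expression is an expression of a graph $G$ if the graph it creates, without its labels, is isomorphic to $G$. The fusion-width $\mathrm{fw}(G)$ (the multi-clique-width $\mathrm{mcw}(G)$) is the smallest $k$ such that $G$ has a fuse-$k$-expression (a multi-$k$-expression). Let $|\phi|$ denote the number of nodes of the parse tree $\phi$. **Theorem.** For every graph $G$, it holds that $\mathrm{mcw}(G)\le \mathrm{fw}(G)+1$. Moreover, there is an algorithm that, given $k$ and a fuse-$k$-expression $\phi$ of a graph $G$, computes a multi-$(k+1)$-expression of $G$ in time polynomial in $|\phi|$ and $k$. -/

import Mathlib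

universe u

/-- A `k`-labeled (simple, undirected) graph; the labels are the elements of `Fin k`. -/
structure LabeledGraph (k : ℕ) where
  V : Type
  graph : SimpleGraph V
  lab : V → Fin k

namespace LabeledGraph

variable {k : ℕ}

/-- Introduce: a single vertex with label `i`. -/
def intro (i : Fin k) : LabeledGraph k where
  V := Unit
  graph := ⊥
  lab _ := i

/-- Disjoint union. -/
def union (A B : LabeledGraph k) : LabeledGraph k where
  V := A.V ⊕ B.V
  graph := A.graph ⊕g B.graph
  lab := Sum.elim A.lab B.lab

/-- Join: add all edges between vertices of label `i` and vertices of label `j`. -/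
def join (i j : Fin k) (A : LabeledGraph k) : LabeledGraph k where
  V := A.V
  graph := A.graph ⊔ SimpleGraph.fromRel (fun u v => A.lab u = i ∧ A.lab v = j)
  lab := A.lab

/-- Relabel: every vertex of label `i` gets label `j` instead. -/
def relabel (i j : Fin k) (A : LabeledGraph k) : LabeledGraph k where
  V := A.V
  graph := A.graph
  lab v := if A.lab v = i then j else A.lab v

/-- Adjacency after fusing the vertices of label `i`: `none` is the vertex that replaces them. -/
def fuseAdj (i : Fin k) (A : LabeledGraph k) :
    Option {v : A.V // A.lab v ≠ i} → Option {v : A.V // A.lab v ≠ i} → Prop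
  | some u, some w => A.graph.Adj u w
  | some u, none => ∃ v, A.lab v = i ∧ A.graph.Adj u v
  | none, some w => ∃ v, A.lab v = i ∧ A.graph.Adj v w
  | none, none => False

/-- Fuse: all vertices of label `i` are replaced by one vertex of label `i` which is adjacent to
every remaining vertex that was adjacent to one of them. (Only used if label `i` occurs.) -/
def fuse (i : Fin k) (A : LabeledGraph k) : LabeledGraph k where
  V := Option {v : A.V // A.lab v ≠ i}
  graph :=
    { Adj := A.fuseAdj i
      symm := ⟨by
        rintro (_ | u) (_ | w) h
        · exact h
        · obtain ⟨v, hv, h⟩ := h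
          exact ⟨v, hv, h.symm⟩
        · obtain ⟨v, hv, h⟩ := h
          exact ⟨v, hv, h.symm⟩
        · exact SimpleGraph.Adj.symm (G := A.graph) h⟩
      loopless := ⟨by
        rintro (_ | u) h
        · exact h
        · exact A.graph.irrefl h⟩ }
  lab
    | none => i
    | some v => A.lab v

end LabeledGraph

/-- Parse trees over the operations introduce, union, join, relabel and fuse, on `k` labels. -/
inductive FuseExpr (k : ℕ) where
  | intro (i : Fin k)
  | union (a b : FuseExpr k)
  | join (i j : Fin k) (a : FuseExpr k)
  | relabel (i j : Fin k) (a : FuseExpr k)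
  | fuse (i : Fin k) (a : FuseExpr k)

namespace FuseExpr

variable {k : ℕ}

/-- The labeled graph arising in an expression. -/
def eval : FuseExpr k → LabeledGraph k
  | intro i => .intro i
  | union a b => .union a.eval b.eval
  | join i j a => .join i j a.eval
  | relabel i j a => .relabel i j a.eval
  | fuse i a => .fuse i a.eval

/-- The side conditions of the operations hold at every node. -/
def WellFormed : FuseExpr k → Prop
  | intro _ => True
  | union a b => a.WellFormed ∧ b.WellFormed
  | join i j a => i ≠ j ∧ a.WellFormed
  | relabel i j a => i ≠ j ∧ a.WellFormed
  | fuse i a => (∃ v, a.eval.lab v = i) ∧ a.WellFormed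

/-- The number of nodes of the parse tree. -/
def size : FuseExpr k → ℕ
  | intro _ => 1
  | union a b => a.size + b.size + 1
  | join _ _ a => a.size + 1
  | relabel _ _ a => a.size + 1
  | fuse _ a => a.size + 1

/-- `φ` is a fuse-`k`-expression of the graph `G` (up to the names of the vertices). -/
def IsExprOf {V : Type u} (φ : FuseExpr k) (G : SimpleGraph V) : Prop :=
  φ.WellFormed ∧ Nonempty (φ.eval.graph ≃g G)

end FuseExpr

/-- A multi-`k`-labeled graph: every vertex holds a set of labels from `Fin k`. -/
structure MultiLabeledGraph (k : ℕ) where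
  V : Type
  graph : SimpleGraph V
  lab : V → Finset (Fin k)

namespace MultiLabeledGraph

variable {k : ℕ}

/-- Introduce: a single vertex with label set `S`. -/
def intro (S : Finset (Fin k)) : MultiLabeledGraph k where
  V := Unit
  graph := ⊥
  lab _ := S

/-- Disjoint union. -/
def union (A B : MultiLabeledGraph k) : MultiLabeledGraph k where
  V := A.V ⊕ B.V
  graph := A.graph ⊕g B.graph
  lab := Sum.elim A.lab B.lab

/-- Join: add all edges between vertices holding label `i` and vertices holding label `j`.
(Only used if no vertex holds both labels.) -/
def join (i j : Fin k) (A : MultiLabeledGraph k) : MultiLabeledGraph k where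
  V := A.V
  graph := A.graph ⊔ SimpleGraph.fromRel (fun u v => i ∈ A.lab u ∧ j ∈ A.lab v)
  lab := A.lab

/-- Relabel: in every label set that contains `i`, replace `i` by the elements of `S`. -/
def relabel (i : Fin k) (S : Finset (Fin k)) (A : MultiLabeledGraph k) :
    MultiLabeledGraph k where
  V := A.V
  graph := A.graph
  lab v := if i ∈ A.lab v then (A.lab v \ {i}) ∪ S else A.lab v

end MultiLabeledGraph

/-- Parse trees over the operations introduce, union, join and relabel for multi-labeled graphs.
A set of labels is written as the list of its elements. -/
inductive MultiExpr (k : ℕ) where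
  | intro (S : List (Fin k))
  | union (a b : MultiExpr k)
  | join (i j : Fin k) (a : MultiExpr k)
  | relabel (i : Fin k) (S : List (Fin k)) (a : MultiExpr k)

namespace MultiExpr

variable {k : ℕ}

/-- The multi-labeled graph arising in an expression. -/
def eval : MultiExpr k → MultiLabeledGraph k
  | intro S => .intro S.toFinset
  | union a b => .union a.eval b.eval
  | join i j a => .join i j a.eval
  | relabel i S a => .relabel i S.toFinset a.eval

/-- The side conditions of the operations hold at every node: label sets are listed without
repetition, an introduced vertex holds at least one label, and `i ≠ j` are joined only if no
vertex holds both of them. -/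
def WellFormed : MultiExpr k → Prop
  | intro S => S ≠ [] ∧ S.Nodup
  | union a b => a.WellFormed ∧ b.WellFormed
  | join i j a => i ≠ j ∧ (∀ v, ¬ (i ∈ a.eval.lab v ∧ j ∈ a.eval.lab v)) ∧ a.WellFormed
  | relabel _ S a => S.Nodup ∧ a.WellFormed

/-- `ψ` is a multi-`k`-expression of the graph `G` (up to the names of the vertices). -/
def IsExprOf {V : Type u} (ψ : MultiExpr k) (G : SimpleGraph V) : Prop :=
  ψ.WellFormed ∧ Nonempty (ψ.eval.graph ≃g G)

end MultiExpr

/-- Fusion-width: the smallest `k` such that `G` has a fuse-`k`-expression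
(`⊤` if there is no such `k`). -/
noncomputable def fusionWidth {V : Type u} (G : SimpleGraph V) : ℕ∞ :=
  ⨅ (k : ℕ) (_ : ∃ φ : FuseExpr k, φ.IsExprOf G), (k : ℕ∞)

/-- Multi-clique-width: the smallest `k` such that `G` has a multi-`k`-expression
(`⊤` if there is no such `k`). -/
noncomputable def multiCliqueWidth {V : Type u} (G : SimpleGraph V) : ℕ∞ :=
  ⨅ (k : ℕ) (_ : ∃ ψ : MultiExpr k, ψ.IsExprOf G), (k : ℕ∞)

/-- The finite alphabet in which expressions are written down for a Turing machine. -/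
inductive ExprSymbol where
  | intro | union | join | relabel | fuse
  | one | sep | close
  deriving DecidableEq

instance : Fintype ExprSymbol where
  elems := {.intro, .union, .join, .relabel, .fuse, .one, .sep, .close}
  complete x := by cases x <;> decide

/-- A number in unary, followed by a separator. -/
def encodeNat (n : ℕ) : List ExprSymbol :=
  List.replicate n .one ++ [.sep]

/-- A list of labels, ended by the symbol `close`. -/
def encodeLabels {k : ℕ} (S : List (Fin k)) : List ExprSymbol :=
  S.flatMap (fun i : Fin k => encodeNat i.val) ++ [.close]

/-- A fuse-expression in Polish (prefix) notation. -/
def FuseExpr.encode {k : ℕ} : FuseExpr k → List ExprSymbol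
  | .intro i => .intro :: encodeNat i
  | .union a b => .union :: (a.encode ++ b.encode)
  | .join i j a => .join :: (encodeNat i ++ encodeNat j ++ a.encode)
  | .relabel i j a => .relabel :: (encodeNat i ++ encodeNat j ++ a.encode)
  | .fuse i a => .fuse :: (encodeNat i ++ a.encode)

/-- A multi-expression in Polish (prefix) notation. -/
def MultiExpr.encode {k : ℕ} : MultiExpr k → List ExprSymbol
  | .intro S => .intro :: encodeLabels S
  | .union a b => .union :: (a.encode ++ b.encode)
  | .join i j a => .join :: (encodeNat i ++ encodeNat j ++ a.encode)
  | .relabel i S a => .relabel :: (encodeNat i ++ encodeLabels S ++ a.encode)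

/-! Multi-labels make fusing unnecessary. A vertex that will later be fused need not exist before
its fusion: it suffices that each of its neighbors already present additionally holds its label, as
a promise of an edge. When the fusion takes place, a single new vertex is introduced and joined to
all vertices holding the promise. The one extra label `last k` singles out this new vertex during
the operation.

For this, each vertex must be created by exactly one fuse. `normalize S` carries down the set `S` of
labels whose vertices are going to be fused by an ancestor. A fuse of a label in `S` is omitted,
since the later fusion subsumes it, and an introduced vertex with a label outside `S` is fused on
its own at once. Relabelings replace `S` by its preimage. In the result, a vertex is absent as long
as its label lies in `S`.

`toMulti` translates such an expression, while `pending` records which absent labels occur and which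
pairs of them are adjacent. In a join of labels `i` and `j`, both absent, only a pair is recorded;
if only `i` is absent, the vertices of label `j` also receive the promise `i`; if neither is absent,
it is an ordinary join. At a fuse of `i`, no present vertex has `i` as its own label, so the
vertices holding `i` are exactly the future neighbors of the new vertex. After the join the promise
`i` is deleted, the new vertex receives a promise for every absent label paired with `i`, and its
label `last k` becomes `i`. The invariant is `RepresentsBy`; `FuseExpr.translates_normalize`
establishes it by induction. At the root `S` is empty, so every vertex is present, and
`FuseExpr.exists_toMulti_isExprOf` follows.

For the algorithm, a small language of stack programs is compiled to `Turing.FinTM2`, with step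
counts (`StackProg.Runs.tm2OutputsInTime`). The program `Prog.translate` reads the prefix notation
and writes the normalized expression in reverse. Reading this reversal evaluates subexpressions
before the operations above them, and pushing the output yields prefix notation again. Each
operation costs a bounded number of passes over a list of at most `4 * φ.size` unary numbers of size
at most `k`, which gives a cubic bound (`Prog.runs_translate`). -/

/-! ### Stack programs and their compilation to Turing machines. -/

/-- Structured programs acting on stacks indexed by `K` with entries in `Γ`. -/
inductive StackProg (K Γ : Type) where
  | skip
  | push (s : K) (x : Γ)
  | seq (p q : StackProg K Γ)
  /-- Pop the stack `s` and continue with the program chosen by the result. -/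
  | popCase (s : K) (f : Option Γ → StackProg K Γ)
  /-- Pop the stack `s`; if the result satisfies `c`, run the body chosen by it and repeat. -/
  | loop (s : K) (c : Option Γ → Bool) (f : Option Γ → StackProg K Γ)

namespace StackProg

variable {K Γ : Type}

/-- `Runs p s s' t`: started with the stacks `s`, the program `p` ends with the stacks `s'` after
at most `t` elementary operations. -/
inductive Runs [DecidableEq K] : StackProg K Γ → (K → List Γ) → (K → List Γ) → ℕ → Prop
  | skip (s) : Runs skip s s 1
  | push (k x s) : Runs (push k x) s (Function.update s k (x :: s k)) 1
  | seq {p q s₁ s₂ s₃ t₁ t₂} (h₁ : Runs p s₁ s₂ t₁) (h₂ : Runs q s₂ s₃ t₂) :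
      Runs (seq p q) s₁ s₃ (t₁ + t₂)
  | popCase {k f s s' t} (h : Runs (f (s k).head?) (Function.update s k (s k).tail) s' t) :
      Runs (popCase k f) s s' (t + 1)
  -- The failing test also consumes its symbol, so a loop over a delimited word swallows the
  -- delimiter.
  | loop_exit {k c f s} (hc : c (s k).head? = false) :
      Runs (loop k c f) s (Function.update s k (s k).tail) 1
  | loop_step {k c f s₁ s₂ s₃ t₁ t₂} (hc : c (s₁ k).head? = true)
      (h₁ : Runs (f (s₁ k).head?) (Function.update s₁ k (s₁ k).tail) s₂ t₁)
      (h₂ : Runs (loop k c f) s₂ s₃ t₂) : Runs (loop k c f) s₁ s₃ (t₁ + t₂ + 1)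
  | mono {p s₁ s₂ t T} (h : Runs p s₁ s₂ t) (ht : t ≤ T) : Runs p s₁ s₂ T

/-- The positions in a program, used as labels of a Turing machine. -/
def Label : StackProg K Γ → Type
  | skip => Unit
  | push _ _ => Unit
  | seq p q => p.Label ⊕ q.Label
  | popCase _ f => Unit ⊕ (Σ o, (f o).Label)
  | loop _ _ f => Unit ⊕ (Σ o, (f o).Label)

theorem finite_label [Finite Γ] (p : StackProg K Γ) : Finite p.Label := by
  induction p with
  | skip => exact inferInstanceAs (Finite Unit)
  | push => exact inferInstanceAs (Finite Unit)
  | seq p q hp hq => exact inferInstanceAs (Finite (p.Label ⊕ q.Label))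
  | popCase s f h => exact inferInstanceAs (Finite (Unit ⊕ (Σ o, (f o).Label)))
  | loop s c f h => exact inferInstanceAs (Finite (Unit ⊕ (Σ o, (f o).Label)))

/-- The position at which a program starts. -/
def entry : (p : StackProg K Γ) → p.Label
  | skip => ()
  | push _ _ => ()
  | seq p _ => Sum.inl p.entry
  | popCase _ _ => Sum.inl ()
  | loop _ _ _ => Sum.inl ()

/-- The statements at the positions of a program which is placed into a machine by `emb` and
followed by the label `next`. -/
def stmt {Λ : Type} : (p : StackProg K Γ) → (emb : p.Label → Λ) → (next : Λ) → p.Label →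
    Turing.TM2.Stmt (fun _ : K => Γ) Λ (Option Γ)
  | skip, _, next, _ => .goto fun _ => next
  | push k x, _, next, _ => .push k (fun _ => x) (.goto fun _ => next)
  | seq p q, emb, _, Sum.inl l => p.stmt (emb ∘ Sum.inl) (emb (Sum.inr q.entry)) l
  | seq _ q, emb, next, Sum.inr l => q.stmt (emb ∘ Sum.inr) next l
  | popCase k f, emb, _, Sum.inl _ =>
      .pop k (fun _ o => o) (.goto fun o => emb (Sum.inr ⟨o, (f o).entry⟩))
  | popCase _ f, emb, next, Sum.inr ⟨o, l⟩ =>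
      (f o).stmt (fun l => emb (Sum.inr ⟨o, l⟩)) next l
  | loop k c f, emb, next, Sum.inl _ =>
      .pop k (fun _ o => o)
        (.branch c (.goto fun o => emb (Sum.inr ⟨o, (f o).entry⟩)) (.goto fun _ => next))
  | loop _ _ f, emb, _, Sum.inr ⟨o, l⟩ =>
      (f o).stmt (fun l => emb (Sum.inr ⟨o, l⟩)) (emb (Sum.inl ())) l

open StateTransition in
theorem evalsToInTime_step {σ : Type*} {f : σ → Option σ} {a b : σ} (h : f a = some b) :
    Nonempty (EvalsToInTime f a (some b) 1) :=
  ⟨⟨⟨1, h⟩, le_rfl⟩⟩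

open StateTransition in
theorem evalsToInTime_trans {σ : Type*} {f : σ → Option σ} {a b : σ} {c : Option σ} {m n : ℕ}
    (h₁ : Nonempty (EvalsToInTime f a (some b) m)) (h₂ : Nonempty (EvalsToInTime f b c n)) :
    Nonempty (EvalsToInTime f a c (m + n)) :=
  ⟨Nat.add_comm n m ▸ EvalsToInTime.trans f m n a b c h₁.some h₂.some⟩

open StateTransition in
theorem evalsToInTime_mono {σ : Type*} {f : σ → Option σ} {a : σ} {c : Option σ} {m n : ℕ}
    (h : Nonempty (EvalsToInTime f a c m)) (hmn : m ≤ n) :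
    Nonempty (EvalsToInTime f a c n) :=
  ⟨⟨h.some.toEvalsTo, h.some.steps_le_m.trans hmn⟩⟩

variable [DecidableEq K]

theorem step_some {Λ σ : Type} {m : Λ → Turing.TM2.Stmt (fun _ : K => Γ) Λ σ} {l : Λ} {v : σ}
    {s : K → List Γ} {q : Turing.TM2.Stmt (fun _ : K => Γ) Λ σ} (h : m l = q) :
    Turing.TM2.step m ⟨some l, v, s⟩ = some (Turing.TM2.stepAux q v s) := by
  rw [← h]; rfl

open StateTransition in
-- Induction over the run, for all placements `emb` and all successor labels at once. The initial
-- memory `v` is arbitrary because memory is consulted only immediately after a pop, which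
-- overwrites it.
theorem Runs.evalsToInTime {Λ : Type} {p : StackProg K Γ} {s s' : K → List Γ} {t : ℕ}
    (h : Runs p s s' t) (m : Λ → Turing.TM2.Stmt (fun _ : K => Γ) Λ (Option Γ))
    (emb : p.Label → Λ) (next : Λ) (hm : ∀ l, m (emb l) = p.stmt emb next l) (v : Option Γ) :
    ∃ v', Nonempty (EvalsToInTime (Turing.TM2.step m) ⟨some (emb p.entry), v, s⟩
      (some ⟨some next, v', s'⟩) t) := by
  induction h generalizing next v with
  | skip s => exact ⟨v, evalsToInTime_step (step_some (hm _))⟩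
  | push k x s => exact ⟨v, evalsToInTime_step (step_some (hm _))⟩
  | @seq p q s₁ s₂ s₃ t₁ t₂ h₁ h₂ ih₁ ih₂ =>
    obtain ⟨v₁, e₁⟩ := ih₁ (emb ∘ Sum.inl) (emb (Sum.inr q.entry)) (fun l => hm (Sum.inl l)) v
    obtain ⟨v₂, e₂⟩ := ih₂ (emb ∘ Sum.inr) next (fun l => hm (Sum.inr l)) v₁
    exact ⟨v₂, evalsToInTime_trans e₁ e₂⟩
  | @popCase k f s s' t h ih =>
    obtain ⟨v₁, e₁⟩ := ih (fun l => emb (Sum.inr ⟨_, l⟩)) next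
      (fun l => hm (Sum.inr ⟨_, l⟩)) (s k).head?
    refine ⟨v₁, ?_⟩
    rw [Nat.add_comm]
    exact evalsToInTime_trans (evalsToInTime_step (step_some (hm (Sum.inl ())))) e₁
  | @loop_exit k c f s hc =>
    refine ⟨(s k).head?, evalsToInTime_step ((step_some (hm (Sum.inl ()))).trans ?_)⟩
    simp only [stmt, Turing.TM2.stepAux, hc, cond_false]
  | @loop_step k c f s₁ s₂ s₃ t₁ t₂ hc h₁ h₂ ih₁ ih₂ =>
    obtain ⟨v₁, e₁⟩ := ih₁ (fun l => emb (Sum.inr ⟨_, l⟩)) (emb (Sum.inl ()))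
      (fun l => hm (Sum.inr ⟨_, l⟩)) (s₁ k).head?
    obtain ⟨v₂, e₂⟩ := ih₂ emb next hm v₁
    refine ⟨v₂, ?_⟩
    rw [Nat.add_comm]
    refine evalsToInTime_trans
      (evalsToInTime_step ((step_some (hm (Sum.inl ()))).trans ?_)) (evalsToInTime_trans e₁ e₂)
    simp only [stmt, Turing.TM2.stepAux, hc, cond_true]
  | mono h ht ih =>
    obtain ⟨v₁, e₁⟩ := ih emb next hm v
    exact ⟨v₁, evalsToInTime_mono e₁ ht⟩

/-- The Turing machine that runs the program `p` and halts, with input stack `k₀` and output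
stack `k₁`. -/
noncomputable def machine [Fintype K] [Fintype Γ] (p : StackProg K Γ) (k₀ k₁ : K) :
    Turing.FinTM2 where
  K := K
  k₀ := k₀
  k₁ := k₁
  Γ _ := Γ
  Λ := Option p.Label
  main := some p.entry
  ΛFin := have := p.finite_label; Fintype.ofFinite _
  σ := Option Γ
  initialState := none
  m
    | some l => p.stmt some none l
    | none => .load (fun _ => none) .halt

/-- `Turing.initList` and `Turing.haltList` describe their stacks by a dependent conditional; this
brings them to the form used in `Runs`. -/
theorem dite_eq_update (k₀ k : K) (l : List Γ) (h : k = k₀ → List Γ) (hl : ∀ e, h e = l) :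
    (if e : k = k₀ then h e else []) = Function.update (fun _ => []) k₀ l k := by
  by_cases hk : k = k₀
  · simp [hk, hl]
  · simp [hk]

/-- The additional step is the halting statement, which also resets the memory to `none`, as
`Turing.haltList` demands. -/
theorem Runs.tm2OutputsInTime [Fintype K] [Fintype Γ] {p : StackProg K Γ} {k₀ k₁ : K}
    {input output : List Γ} {t : ℕ}
    (h : Runs p (Function.update (fun _ => []) k₀ input)
      (Function.update (fun _ => []) k₁ output) t) :
    Nonempty (Turing.TM2OutputsInTime (p.machine k₀ k₁) input (some output) (t + 1)) := by
  obtain ⟨v, e⟩ := h.evalsToInTime (p.machine k₀ k₁).m some none (fun _ => rfl) none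
  have e' := evalsToInTime_trans e (evalsToInTime_step (b := ⟨none, none,
    Function.update (fun _ => []) k₁ output⟩) rfl)
  have h₀ : Turing.initList (p.machine k₀ k₁) input =
      ⟨some (some p.entry), none, Function.update (fun _ => []) k₀ input⟩ :=
    congrArg (Turing.TM2.Cfg.mk _ _)
      (funext fun k => dite_eq_update (K := K) k₀ k input _ fun _ => rfl)
  have h₁ : Turing.haltList (p.machine k₀ k₁) output =
      ⟨none, none, Function.update (fun _ => []) k₁ output⟩ :=
    congrArg (Turing.TM2.Cfg.mk _ _)
      (funext fun k => dite_eq_update (K := K) k₁ k output _ fun _ => rfl)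
  change Nonempty (StateTransition.EvalsToInTime (p.machine k₀ k₁).step
    (Turing.initList (p.machine k₀ k₁) input) (some (Turing.haltList (p.machine k₀ k₁) output)) _)
  rw [h₀, h₁]
  exact e'

end StackProg

/-! ### Normalization of fuse-expressions and their translation. -/

open Fin (last castSucc)

namespace FuseExpr

variable {k : ℕ}

/-- The labels that the relabeling `i → j` maps into the set `S`. -/
def relabelPreimage (i j : Fin k) (S : List (Fin k)) : List (Fin k) :=
  if j ∈ S then i :: S.filter (· ≠ i) else S.filter (· ≠ i)

/-- If the labels in `S` are going to be fused, a fuse operation on one of them can be omitted.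
In the resulting expression, every vertex is fused exactly once, together with those that are to
become one vertex, except for the vertices whose labels are in `S` at the end. -/
def normalize : List (Fin k) → FuseExpr k → FuseExpr k
  | S, intro i => if i ∈ S then intro i else fuse i (intro i)
  | S, union a b => union (normalize S a) (normalize S b)
  | S, join i j a => join i j (normalize S a)
  | S, relabel i j a => relabel i j (normalize (relabelPreimage i j S) a)
  | S, fuse i a => if i ∈ S then normalize S a else fuse i (normalize (i :: S) a)

/-- The entries of the pairs in a list. -/
def entries (I : List (Fin k × Fin k)) : List (Fin k) :=
  I.flatMap fun p => [p.1, p.2]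

/-- For a normalized expression: a pair `(i, i)` for every label `i` of vertices that are not yet
fused, and a pair `(i, j)` if vertices with such labels `i` and `j` are adjacent. -/
def pending : FuseExpr k → List (Fin k × Fin k)
  | intro i => [(i, i)]
  | union a b => a.pending ++ b.pending
  | join i j a =>
      if i ∈ entries a.pending ∧ j ∈ entries a.pending then (i, j) :: a.pending else a.pending
  | relabel i j a =>
      a.pending.map (Prod.map (fun x => if x = i then j else x) (fun x => if x = i then j else x))
  | fuse i a => a.pending.filter fun p => p.1 ≠ i ∧ p.2 ≠ i

/-- Give the vertices holding the extra label `last k` all labels that are paired with `i`. -/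
def addPartners (i : Fin k) : List (Fin k × Fin k) → MultiExpr (k + 1) → MultiExpr (k + 1)
  | [], e => e
  | p :: I, e => addPartners i I
      (if p.1 = i then .relabel (last k) [last k, castSucc p.2] e
        else if p.2 = i then .relabel (last k) [last k, castSucc p.1] e else e)

/-- Translation of a normalized expression into a multi-expression. Vertices that are not yet
fused are absent; instead their neighbors hold their label in addition to their own. -/
def toMulti : FuseExpr k → Option (MultiExpr (k + 1))
  | intro _ => none
  | union a b =>
      match a.toMulti, b.toMulti with
      | some x, some y => some (.union x y)
      | some x, none => some x
      | none, y => y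
  | join i j a => a.toMulti.map fun e =>
      if i ∈ entries a.pending then
        if j ∈ entries a.pending then e
        else .relabel (castSucc j) [castSucc j, castSucc i] e
      else if j ∈ entries a.pending then .relabel (castSucc i) [castSucc i, castSucc j] e
      else .join (castSucc i) (castSucc j) e
  | relabel i j a => a.toMulti.map (.relabel (castSucc i) [castSucc j])
  | fuse i a =>
      some (.relabel (last k) [castSucc i] (addPartners i a.pending
        (.relabel (castSucc i) [] (.join (last k) (castSucc i)
          (match a.toMulti with
          | some e => .union (.intro [last k]) e
          | none => .intro [last k])))))

end FuseExpr

/-! ### The invariant and its behavior under the operations. -/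

/-- The multi-labeled graph without vertices. -/
def MultiLabeledGraph.empty (k : ℕ) : MultiLabeledGraph k where
  V := Empty
  graph := ⊥
  lab := Empty.elim

/-- The graph of an expression that may be missing. -/
def MultiExpr.evalOption {k : ℕ} : Option (MultiExpr k) → MultiLabeledGraph k
  | some e => e.eval
  | none => .empty k

/-- Along `f`, the graph `H` with the label sets `labs` represents the graph `G` with the labels
`lab` in which the labels in `S` are still to be fused and the pairs in `I` are pending. -/
structure RepresentsBy {k : ℕ} {W V : Type} (S : List (Fin k)) (G : SimpleGraph W)
    (lab : W → Fin k) (I : List (Fin k × Fin k)) (H : SimpleGraph V)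
    (labs : V → Finset (Fin (k + 1))) (f : V → W) : Prop where
  inj : Function.Injective f
  range : ∀ v, (∃ x, f x = v) ↔ lab v ∉ S
  adj : ∀ x y, H.Adj x y ↔ G.Adj (f x) (f y)
  last_notMem : ∀ x, last k ∉ labs x
  mem_labs : ∀ x j, castSucc j ∈ labs x ↔
    j = lab (f x) ∨ j ∈ S ∧ ∃ v, lab v = j ∧ G.Adj (f x) v
  -- Diagonal pairs record occurrence and never an edge: edges inside an absent label class vanish
  -- when it is fused. A relabeling may make an off-diagonal pair diagonal; it then only repeats
  -- that the label occurs. Hence `edge` is restricted to distinct labels.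
  occurs : ∀ i, (i, i) ∈ I ↔ i ∈ S ∧ ∃ v, lab v = i
  edge : ∀ i j, i ≠ j → ((i, j) ∈ I ∨ (j, i) ∈ I ↔
    i ∈ S ∧ j ∈ S ∧ ∃ u v, lab u = i ∧ lab v = j ∧ G.Adj u v)

namespace RepresentsBy

variable {k : ℕ} {W V : Type} {S : List (Fin k)} {G : SimpleGraph W} {lab : W → Fin k}
  {I : List (Fin k × Fin k)} {H : SimpleGraph V} {labs : V → Finset (Fin (k + 1))} {f : V → W}

theorem lab_notMem (h : RepresentsBy S G lab I H labs f) (x : V) : lab (f x) ∉ S :=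
  (h.range _).1 ⟨x, rfl⟩

/-- An off-diagonal pair comes from an edge, so both of its entries occur and lie in `S`. Membership
in `entries` is therefore a decidable test for a label having absent vertices. -/
theorem mem_entries (h : RepresentsBy S G lab I H labs f) (i : Fin k) :
    i ∈ FuseExpr.entries I ↔ i ∈ S ∧ ∃ v, lab v = i := by
  rw [← h.occurs]
  simp only [FuseExpr.entries, List.mem_flatMap, List.mem_cons, List.not_mem_nil, or_false,
    Prod.exists]
  constructor
  · rintro ⟨a, b, hab, hi⟩
    by_cases e : a = b
    · subst e
      obtain rfl : i = a := by tauto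
      exact hab
    · obtain ⟨ha, hb, u, v, hu, hv, -⟩ := (h.edge a b e).1 (Or.inl hab)
      rw [h.occurs]
      rcases hi with rfl | rfl
      · exact ⟨ha, u, hu⟩
      · exact ⟨hb, v, hv⟩
  · exact fun hi => ⟨i, i, hi, Or.inl rfl⟩

/-- Without absent vertices of label `i` there are no promises of `i`. -/
theorem mem_labs_iff (h : RepresentsBy S G lab I H labs f) {i : Fin k}
    (hi : i ∉ FuseExpr.entries I) (x : V) : castSucc i ∈ labs x ↔ lab (f x) = i := by
  rw [h.mem_entries] at hi
  rw [h.mem_labs]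
  grind

theorem congr_right {V' : Type} {H' : SimpleGraph V'} {labs' : V' → Finset (Fin (k + 1))}
    (h : RepresentsBy S G lab I H labs f) (e : V' ≃ V)
    (hadj : ∀ x y, H'.Adj x y ↔ H.Adj (e x) (e y)) (hlab : ∀ x, labs' x = labs (e x)) :
    RepresentsBy S G lab I H' labs' (f ∘ e) := by
  refine ⟨h.inj.comp e.injective, fun v => ?_, fun x y => ?_, fun x => ?_, fun x j => ?_,
    h.occurs, h.edge⟩
  · rw [← h.range]
    exact e.surjective.exists (p := fun x => f x = v) |>.symm
  · rw [hadj, h.adj]; rfl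
  · rw [hlab]; exact h.last_notMem _
  · rw [hlab]; exact h.mem_labs _ _

theorem congr_left {W' : Type} {G' : SimpleGraph W'} {lab' : W' → Fin k}
    (h : RepresentsBy S G lab I H labs f) (e : W ≃ W')
    (hadj : ∀ x y, G.Adj x y ↔ G'.Adj (e x) (e y)) (hlab : ∀ x, lab x = lab' (e x)) :
    RepresentsBy S G' lab' I H labs (e ∘ f) := by
  refine ⟨e.injective.comp h.inj, fun v => ?_, fun x y => ?_, h.last_notMem,
    fun x j => ?_, fun i => ?_, fun i j hij => ?_⟩
  · obtain ⟨v, rfl⟩ := e.surjective v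
    simp only [Function.comp_apply, e.apply_eq_iff_eq, h.range, hlab]
  · rw [h.adj, hadj]; rfl
  · rw [h.mem_labs, ← e.surjective.exists.symm]
    simp only [Function.comp_apply, hadj, hlab]
  · rw [h.occurs, e.surjective.exists]
    simp only [hlab]
  · rw [h.edge i j hij, e.surjective.exists]
    simp only [hlab, hadj, e.surjective.exists]

theorem single {i : Fin k} (hi : i ∈ S) :
    RepresentsBy S (⊥ : SimpleGraph Unit) (fun _ => i) [(i, i)] (⊥ : SimpleGraph Empty)
      Empty.elim Empty.elim := by
  refine ⟨fun x => x.elim, fun v => ?_, fun x => x.elim, fun x => x.elim,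
    fun x => x.elim, fun j => ?_, fun j l hjl => ?_⟩
  · simp [hi]
  · simp only [List.mem_singleton, Prod.mk.injEq, and_self]
    constructor
    · rintro rfl; exact ⟨hi, (), rfl⟩
    · rintro ⟨-, -, rfl⟩; rfl
  · simp
    grind

theorem union {W' V' : Type} {G' : SimpleGraph W'} {lab' : W' → Fin k}
    {J : List (Fin k × Fin k)} {H' : SimpleGraph V'} {labs' : V' → Finset (Fin (k + 1))}
    {g : V' → W'} (h : RepresentsBy S G lab I H labs f) (h' : RepresentsBy S G' lab' J H' labs' g) :
    RepresentsBy S (G ⊕g G') (Sum.elim lab lab') (I ++ J) (H ⊕g H') (Sum.elim labs labs')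
      (Sum.map f g) := by
  refine ⟨h.inj.sumMap h'.inj, ?_, ?_, ?_, ?_, fun i => ?_, fun i j hij => ?_⟩
  · rintro (v | v)
    · simpa using h.range v
    · simpa using h'.range v
  · rintro (x | x) (y | y) <;> simp [h.adj, h'.adj]
  · rintro (x | x)
    · exact h.last_notMem x
    · exact h'.last_notMem x
  · rintro (x | x) j
    · simpa using h.mem_labs x j
    · simpa using h'.mem_labs x j
  · simp only [List.mem_append, h.occurs, h'.occurs, Sum.exists, Sum.elim_inl, Sum.elim_inr]
    tauto
  · have e₁ := h.edge i j hij
    have e₂ := h'.edge i j hij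
    simp only [List.mem_append, Sum.exists, Sum.elim_inl, Sum.elim_inr, SimpleGraph.sum_adj]
    simp only [and_false, exists_false, or_false, false_or, exists_and_left] at e₁ e₂ ⊢
    rw [or_or_or_comm, e₁, e₂, ← and_or_left, ← and_or_left]

end RepresentsBy

namespace RepresentsBy

variable {k : ℕ} {W V : Type} {S : List (Fin k)} {G G' : SimpleGraph W} {lab : W → Fin k}
  {I : List (Fin k × Fin k)} {H : SimpleGraph V} {labs : V → Finset (Fin (k + 1))} {f : V → W}
  {i j : Fin k}

/-- Labels of present vertices lie outside `S`, so every new edge runs between two absent vertices.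
-/
theorem join_of_mem_of_mem (h : RepresentsBy S G lab I H labs f)
    (hG : ∀ u v, G'.Adj u v ↔ G.Adj u v ∨ lab u = i ∧ lab v = j ∨ lab v = i ∧ lab u = j)
    (hi : i ∈ FuseExpr.entries I) (hj : j ∈ FuseExpr.entries I) (hij : i ≠ j) :
    RepresentsBy S G' lab ((i, j) :: I) H labs f := by
  rw [h.mem_entries] at hi hj
  have hS := h.lab_notMem
  refine ⟨h.inj, h.range, fun x y => ?_, h.last_notMem, fun x l => ?_, fun l => ?_,
    fun l m hlm => ?_⟩
  · rw [h.adj, hG]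
    grind
  · rw [h.mem_labs]
    simp only [hG]
    grind
  · have := h.occurs l
    grind
  · have := h.edge l m hlm
    simp only [hG]
    grind

/-- By `mem_labs_iff`, exactly the present vertices whose own label is `j` are affected. They gain a
true promise, as an absent vertex of label `i` exists. -/
theorem join_of_mem_of_notMem (h : RepresentsBy S G lab I H labs f)
    (hG : ∀ u v, G'.Adj u v ↔ G.Adj u v ∨ lab u = i ∧ lab v = j ∨ lab v = i ∧ lab u = j)
    (hi : i ∈ FuseExpr.entries I) (hj : j ∉ FuseExpr.entries I) :
    RepresentsBy S G' lab I H (fun x => if castSucc j ∈ labs x then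
      (labs x \ {castSucc j}) ∪ {castSucc j, castSucc i} else labs x) f := by
  have hjl := h.mem_labs_iff hj
  rw [h.mem_entries] at hi hj
  have hS := h.lab_notMem
  refine ⟨h.inj, h.range, fun x y => ?_, fun x => ?_, fun x l => ?_, h.occurs,
    fun l m hlm => ?_⟩
  · rw [h.adj, hG]
    grind
  · have := h.last_notMem x
    have h₁ := Fin.castSucc_ne_last i
    have h₂ := Fin.castSucc_ne_last j
    grind
  · have := h.mem_labs x l
    have e₁ := Fin.castSucc_inj (a := l) (b := i)
    have e₂ := Fin.castSucc_inj (a := l) (b := j)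
    simp only [hG, hjl]
    grind
  · have := h.edge l m hlm
    simp only [hG]
    grind

theorem join_of_notMem_of_notMem {H' : SimpleGraph V} (h : RepresentsBy S G lab I H labs f)
    (hG : ∀ u v, G'.Adj u v ↔ G.Adj u v ∨ lab u = i ∧ lab v = j ∨ lab v = i ∧ lab u = j)
    (hH : ∀ x y, H'.Adj x y ↔ H.Adj x y ∨ castSucc i ∈ labs x ∧ castSucc j ∈ labs y ∨
      castSucc i ∈ labs y ∧ castSucc j ∈ labs x)
    (hi : i ∉ FuseExpr.entries I) (hj : j ∉ FuseExpr.entries I) :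
    RepresentsBy S G' lab I H' labs f := by
  have hil := h.mem_labs_iff hi
  have hjl := h.mem_labs_iff hj
  rw [h.mem_entries] at hi hj
  refine ⟨h.inj, h.range, fun x y => ?_, h.last_notMem, fun x l => ?_, h.occurs,
    fun l m hlm => ?_⟩
  · rw [hG, hH, h.adj]
    simp only [hil, hjl]
  · have := h.mem_labs x l
    simp only [hG]
    grind
  · have := h.edge l m hlm
    simp only [hG]
    grind

theorem _root_.FuseExpr.mem_relabelPreimage {i j : Fin k} (l : Fin k) :
    l ∈ FuseExpr.relabelPreimage i j S ↔ (if l = i then j else l) ∈ S := by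
  unfold FuseExpr.relabelPreimage
  split_ifs <;> grind

/-- The same relabeling serves own labels and promises. The two cannot be confused: `i` lies in the
preimage of `S` if and only if `j` does, so after the merge the label is still either absent or
present as a whole. -/
theorem relabel (h : RepresentsBy (FuseExpr.relabelPreimage i j S) G lab I H labs f)
    (hij : i ≠ j) :
    RepresentsBy S G (fun v => if lab v = i then j else lab v)
      (I.map (Prod.map (fun x => if x = i then j else x) (fun x => if x = i then j else x))) H
      (fun x => if castSucc i ∈ labs x then (labs x \ {castSucc i}) ∪ {castSucc j}
        else labs x) f := by
  have hmem := FuseExpr.mem_relabelPreimage (i := i) (j := j) (S := S)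
  refine ⟨h.inj, fun v => ?_, h.adj, fun x => ?_, fun x l => ?_, fun l => ?_,
    fun l m hlm => ?_⟩
  · exact (h.range v).trans (not_congr (hmem _))
  · have := h.last_notMem x
    have h₁ := Fin.castSucc_ne_last i
    have h₂ := Fin.castSucc_ne_last j
    grind
  · have h₁ := h.mem_labs x l
    have h₂ := h.mem_labs x i
    have e₁ := Fin.castSucc_inj (a := l) (b := i)
    have e₂ := Fin.castSucc_inj (a := l) (b := j)
    have e₃ := Fin.castSucc_inj (a := i) (b := j)
    rw [hmem] at h₁ h₂
    grind
  · have h₁ := h.occurs l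
    have h₂ := h.occurs i
    have h₃ := h.edge i j hij
    simp only [List.mem_map, Prod.exists, Prod.map_apply, Prod.mk.injEq]
    simp only [hmem] at h₁ h₂ h₃
    grind
  · have h₁ := h.edge l m hlm
    have h₂ := h.edge i m
    have h₃ := h.edge l i
    simp only [List.mem_map, Prod.exists, Prod.map_apply, Prod.mk.injEq]
    simp only [hmem] at h₁ h₂ h₃
    grind

variable {F : SimpleGraph (Option {v : W // lab v ≠ i})}
  {lab' : Option {v : W // lab v ≠ i} → Fin k}

/-- Justifies omitting a fuse. The vertices of label `i` stay absent, and the invariant only sees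
which labels their class is adjacent to and which present vertices neighbor it, neither of which
fusing changes. Since `i` occurs after the fusion, it has to occur before; this is the side
condition of fuse. -/
theorem fuse_of_mem (h : RepresentsBy S G lab I H labs f)
    (hs : ∀ u w, F.Adj (some u) (some w) ↔ G.Adj u w)
    (hn : ∀ w, F.Adj none (some w) ↔ ∃ v, lab v = i ∧ G.Adj v w)
    (ls : ∀ v, lab' (some v) = lab v) (ln : lab' none = i)
    (hi : i ∈ S) (ho : ∃ v, lab v = i) :
    RepresentsBy S F lab' I H labs
      (fun x => some ⟨f x, fun e => h.lab_notMem x (e ▸ hi)⟩) := by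
  have hn' : ∀ w, F.Adj (some w) none ↔ ∃ v, lab v = i ∧ G.Adj w v := by
    intro w
    rw [F.adj_comm, hn]
    simp only [G.adj_comm]
  refine ⟨fun x y e => h.inj (by simpa using e), ?_, fun x y => ?_, h.last_notMem, fun x l => ?_,
    fun l => ?_, fun l m hlm => ?_⟩
  · rintro (_ | ⟨v, hv⟩)
    · simp [ln, hi]
    · simpa [ls] using h.range v
  · rw [h.adj, hs]
  · rw [h.mem_labs]
    simp only [ls, Option.exists, ln, hn', hs, Subtype.exists]
    grind
  · rw [h.occurs]
    simp only [ls, Option.exists, ln, Subtype.exists]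
    grind
  · rw [h.edge l m hlm]
    simp only [ls, Option.exists, ln, hn', hs, hn, Subtype.exists]
    have := F.irrefl (v := none)
    grind

/-- The new vertex is `Sum.inl ()`. Since `i` belongs to `i :: S`, every present vertex holding `i`
holds it as a promise, so `hb` gives exactly the neighborhood of the fused vertex. Afterwards `i` is
no longer absent, so `la` deletes the fulfilled promises, and `lb` turns the pairs containing `i`
into promises of the new vertex. -/
theorem fuse_of_notMem {H' : SimpleGraph (Unit ⊕ V)} {labs' : Unit ⊕ V → Finset (Fin (k + 1))}
    (h : RepresentsBy (i :: S) G lab I H labs f)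
    (hs : ∀ u w, F.Adj (some u) (some w) ↔ G.Adj u w)
    (hn : ∀ w, F.Adj none (some w) ↔ ∃ v, lab v = i ∧ G.Adj v w)
    (ls : ∀ v, lab' (some v) = lab v) (ln : lab' none = i)
    (ha : ∀ x y, H'.Adj (Sum.inr x) (Sum.inr y) ↔ H.Adj x y)
    (hb : ∀ x, H'.Adj (Sum.inl ()) (Sum.inr x) ↔ castSucc i ∈ labs x)
    (la : ∀ x, labs' (Sum.inr x) = labs x \ {castSucc i})
    (lb : ∀ l, castSucc l ∈ labs' (Sum.inl ()) ↔ l = i ∨ (i, l) ∈ I ∨ (l, i) ∈ I)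
    (lb' : last k ∉ labs' (Sum.inl ())) (hi : i ∉ S) :
    RepresentsBy S F lab' (I.filter fun p => p.1 ≠ i ∧ p.2 ≠ i) H' labs'
      (Sum.elim (fun _ => none)
        (fun x => some ⟨f x, fun e => h.lab_notMem x (e ▸ List.mem_cons_self)⟩)) := by
  have hn' : ∀ w, F.Adj (some w) none ↔ ∃ v, lab v = i ∧ G.Adj w v := by
    intro w
    rw [F.adj_comm, hn]
    simp only [G.adj_comm]
  have hS := h.lab_notMem
  refine ⟨?_, ?_, ?_, ?_, ?_, fun l => ?_, fun l m hlm => ?_⟩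
  · rintro (x | x) (y | y) e
    · rfl
    · simp at e
    · simp at e
    · simpa [h.inj.eq_iff] using e
  · rintro (_ | ⟨v, hv⟩)
    · simp [ln, hi]
    · simpa [ls, hv] using h.range v
  · rintro (x | x) (y | y)
    · simp
    · rw [hb]
      simp only [Sum.elim_inl, Sum.elim_inr, hn, h.mem_labs, G.adj_comm (f y)]
      grind
    · rw [H'.adj_comm, hb]
      simp only [Sum.elim_inl, Sum.elim_inr, hn', h.mem_labs]
      grind
    · simp only [Sum.elim_inr, ha, hs, h.adj]
  · rintro (x | x)
    · exact lb'
    · simp [la, h.last_notMem]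
  · rintro (x | x) l
    · rw [lb]
      have := h.edge i l
      simp only [ls, Option.exists, ln, hn, Subtype.exists, Sum.elim_inl, F.irrefl]
      grind
    · rw [la, Finset.mem_sdiff, h.mem_labs]
      simp only [ls, Option.exists, ln, hn', hs, Subtype.exists, Sum.elim_inr,
        Finset.mem_singleton, Fin.castSucc_inj]
      grind
  · simp only [List.mem_filter, h.occurs, ls, Option.exists, ln, Subtype.exists]
    grind
  · have := h.edge l m hlm
    simp only [List.mem_filter, ls, Option.exists, ln, hn', hs, hn, Subtype.exists]
    grind

end RepresentsBy

/-! ### Label-set operations and the invariant for labeled graphs. -/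

namespace MultiLabeledGraph

variable {k : ℕ}

/-- Add the labels in `N` to all label sets that contain `last k`. -/
def addLabels (N : Finset (Fin (k + 1))) (M : MultiLabeledGraph (k + 1)) :
    MultiLabeledGraph (k + 1) where
  V := M.V
  graph := M.graph
  lab v := if last k ∈ M.lab v then M.lab v ∪ N else M.lab v

theorem addLabels_empty (M : MultiLabeledGraph (k + 1)) : M.addLabels ∅ = M := by
  simp [addLabels]

theorem addLabels_addLabels (N N' : Finset (Fin (k + 1))) (M : MultiLabeledGraph (k + 1)) :
    (M.addLabels N).addLabels N' = M.addLabels (N ∪ N') := by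
  simp only [addLabels, mk.injEq, heq_eq_eq, true_and]
  funext v
  grind

/-- Keeping `last k` in the replacing set makes a relabeling purely additive, so partners can be
added one at a time. -/
theorem relabel_last (y : Fin (k + 1)) (M : MultiLabeledGraph (k + 1)) :
    M.relabel (last k) {last k, y} = M.addLabels {y} := by
  simp only [addLabels, relabel, mk.injEq, heq_eq_eq, true_and]
  funext v
  grind

/-- The side condition makes the inequality of endpoints in `SimpleGraph.fromRel` automatic. -/
theorem join_adj {k : ℕ} {M : MultiLabeledGraph k} {i j : Fin k}
    (hij : ∀ x, ¬ (i ∈ M.lab x ∧ j ∈ M.lab x)) (u v : M.V) :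
    (M.join i j).graph.Adj u v ↔
      M.graph.Adj u v ∨ i ∈ M.lab u ∧ j ∈ M.lab v ∨ i ∈ M.lab v ∧ j ∈ M.lab u := by
  change M.graph.Adj u v ∨ (u ≠ v ∧ _) ↔ _
  grind

end MultiLabeledGraph

theorem LabeledGraph.join_adj {k : ℕ} {A : LabeledGraph k} {i j : Fin k} (hij : i ≠ j)
    (u v : A.V) : (A.join i j).graph.Adj u v ↔
      A.graph.Adj u v ∨ A.lab u = i ∧ A.lab v = j ∨ A.lab v = i ∧ A.lab u = j := by
  change A.graph.Adj u v ∨ (u ≠ v ∧ _) ↔ _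
  grind

/-- The labels that are paired with `i`. -/
def FuseExpr.partners {k : ℕ} (i : Fin k) : List (Fin k × Fin k) → Finset (Fin (k + 1))
  | [] => ∅
  | p :: I => (if p.1 = i then {castSucc p.2} else if p.2 = i then {castSucc p.1} else ∅) ∪
      partners i I

theorem FuseExpr.mem_partners {k : ℕ} (i l : Fin k) (I : List (Fin k × Fin k)) :
    castSucc l ∈ partners i I ↔ (i, l) ∈ I ∨ (l, i) ∈ I := by
  induction I with
  | nil => simp [partners]
  | cons p I ih =>
    obtain ⟨a, b⟩ := p
    have h₁ := Fin.castSucc_inj (a := l) (b := a)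
    have h₂ := Fin.castSucc_inj (a := l) (b := b)
    simp only [partners, Finset.mem_union, ih]
    grind

theorem FuseExpr.last_notMem_partners {k : ℕ} (i : Fin k) (I : List (Fin k × Fin k)) :
    last k ∉ partners i I := by
  induction I with
  | nil => simp [partners]
  | cons p I ih =>
    have h₁ := Fin.castSucc_ne_last p.1
    have h₂ := Fin.castSucc_ne_last p.2
    simp only [partners, Finset.mem_union, ih]
    grind

theorem FuseExpr.eval_addPartners {k : ℕ} (i : Fin k) (I : List (Fin k × Fin k))
    (e : MultiExpr (k + 1)) :
    (addPartners i I e).eval = e.eval.addLabels (partners i I) := by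
  induction I generalizing e with
  | nil => simp [addPartners, partners, MultiLabeledGraph.addLabels_empty]
  | cons p I ih =>
    rw [addPartners, ih, partners, ← MultiLabeledGraph.addLabels_addLabels]
    congr 1
    split_ifs
    · simp [MultiExpr.eval, ← MultiLabeledGraph.relabel_last]
    · simp [MultiExpr.eval, ← MultiLabeledGraph.relabel_last]
    · rw [MultiLabeledGraph.addLabels_empty]

theorem FuseExpr.wellFormed_addPartners {k : ℕ} (i : Fin k) (I : List (Fin k × Fin k))
    (e : MultiExpr (k + 1)) (he : e.WellFormed) : (addPartners i I e).WellFormed := by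
  induction I generalizing e with
  | nil => exact he
  | cons p I ih =>
    rw [addPartners]
    apply ih
    have h₁ := (Fin.castSucc_ne_last p.1).symm
    have h₂ := (Fin.castSucc_ne_last p.2).symm
    split_ifs <;> simp [MultiExpr.WellFormed, he, h₁, h₂]

/-- `M` represents the labeled graph `A` in which the labels in `S` are still to be fused and the
pairs in `I` are pending. -/
def Represents {k : ℕ} (S : List (Fin k)) (A : LabeledGraph k) (I : List (Fin k × Fin k))
    (M : MultiLabeledGraph (k + 1)) : Prop :=
  ∃ f : M.V → A.V, RepresentsBy S A.graph A.lab I M.graph M.lab f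

section

variable {k : ℕ} {S : List (Fin k)} {A B : LabeledGraph k} {I J : List (Fin k × Fin k)}
  {M N : MultiLabeledGraph (k + 1)} {i j : Fin k}

/-- A missing expression may stay missing under joins and relabelings, which do nothing to a graph
without vertices. -/
theorem Represents.congr_empty (h : Represents S A I M) (hM : IsEmpty M.V) :
    Represents S A I (MultiLabeledGraph.empty _) := by
  obtain ⟨f, h⟩ := h
  exact ⟨_, h.congr_right (Equiv.equivOfIsEmpty Empty M.V) (fun x => x.elim) (fun x => x.elim)⟩

theorem Represents.union (h : Represents S A I M) (h' : Represents S B J N) :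
    Represents S (A.union B) (I ++ J) (M.union N) := by
  obtain ⟨f, hf⟩ := h
  obtain ⟨g, hg⟩ := h'
  exact ⟨_, hf.union hg⟩

/-- The effect of a relabeling on one label set. -/
def relabelSet (i : Fin k) (S L : Finset (Fin k)) : Finset (Fin k) :=
  if i ∈ L then (L \ {i}) ∪ S else L

/-- The effect of `MultiLabeledGraph.addLabels` on one label set. -/
def addSet (N L : Finset (Fin (k + 1))) : Finset (Fin (k + 1)) :=
  if last k ∈ L then L ∪ N else L

theorem relabelSet_addSet_relabelSet_of_notMem {i : Fin (k + 1)} {T N L : Finset (Fin (k + 1))}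
    (hL : last k ∉ L) :
    relabelSet (last k) T (addSet N (relabelSet i ∅ L)) = L \ {i} := by
  unfold relabelSet addSet
  grind

theorem mem_relabelSet_addSet_singleton {N : Finset (Fin (k + 1))} (l : Fin k) :
    castSucc l ∈ relabelSet (last k) {castSucc i} (addSet N (relabelSet (castSucc i) ∅ {last k})) ↔
      l = i ∨ castSucc l ∈ N := by
  have h₂ := Fin.castSucc_inj (a := l) (b := i)
  have h₃ := Fin.castSucc_ne_last l
  unfold relabelSet addSet
  grind

theorem last_notMem_relabelSet_addSet_singleton {N : Finset (Fin (k + 1))}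
    (hi : castSucc i ≠ last k) (hN : last k ∉ N) :
    last k ∉ relabelSet (last k) {castSucc i}
      (addSet N (relabelSet (castSucc i) ∅ {last k})) := by
  unfold relabelSet addSet
  grind

theorem Represents.join_of_mem_of_notMem (h : Represents S A I M) (hij : i ≠ j)
    (hi : i ∈ FuseExpr.entries I) (hj : j ∉ FuseExpr.entries I) :
    Represents S (A.join i j) I (M.relabel (castSucc j) {castSucc j, castSucc i}) := by
  obtain ⟨f, h⟩ := h
  exact ⟨f, h.join_of_mem_of_notMem (LabeledGraph.join_adj hij) hi hj⟩

theorem Represents.join_of_notMem_of_mem (h : Represents S A I M) (hij : i ≠ j)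
    (hi : i ∉ FuseExpr.entries I) (hj : j ∈ FuseExpr.entries I) :
    Represents S (A.join i j) I (M.relabel (castSucc i) {castSucc i, castSucc j}) := by
  obtain ⟨f, h⟩ := h
  exact ⟨f, h.join_of_mem_of_notMem
    (fun u v => (LabeledGraph.join_adj hij u v).trans (by tauto)) hj hi⟩

theorem Represents.join_of_notMem_of_notMem (h : Represents S A I M) (hij : i ≠ j)
    (hi : i ∉ FuseExpr.entries I) (hj : j ∉ FuseExpr.entries I) :
    (∀ x, ¬ (castSucc i ∈ M.lab x ∧ castSucc j ∈ M.lab x)) ∧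
      Represents S (A.join i j) I (M.join (castSucc i) (castSucc j)) := by
  obtain ⟨f, h⟩ := h
  have hd : ∀ x, ¬ (castSucc i ∈ M.lab x ∧ castSucc j ∈ M.lab x) := by
    intro x
    rw [h.mem_labs_iff hi, h.mem_labs_iff hj]
    grind
  exact ⟨hd, f, h.join_of_notMem_of_notMem (LabeledGraph.join_adj hij)
    (MultiLabeledGraph.join_adj hd) hi hj⟩

theorem Represents.relabel (h : Represents (FuseExpr.relabelPreimage i j S) A I M)
    (hij : i ≠ j) :
    Represents S (A.relabel i j)
      (I.map (Prod.map (fun x => if x = i then j else x) (fun x => if x = i then j else x)))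
      (M.relabel (castSucc i) {castSucc j}) := by
  obtain ⟨f, h⟩ := h
  exact ⟨f, h.relabel hij⟩

theorem Represents.fuse_of_notMem (h : Represents (i :: S) A I M) (hi : i ∉ S) :
    Represents S (A.fuse i) (I.filter fun p => p.1 ≠ i ∧ p.2 ≠ i)
      ((((((MultiLabeledGraph.intro {last k}).union M).join (last k) (castSucc i)).relabel
        (castSucc i) ∅).addLabels (FuseExpr.partners i I)).relabel (last k) {castSucc i}) := by
  obtain ⟨f, h⟩ := h
  -- The side condition of the join: only the new vertex holds `last k`, and it holds nothing else.
  have hd : ∀ x, ¬ (last k ∈ ((MultiLabeledGraph.intro {last k}).union M).lab x ∧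
      castSucc i ∈ ((MultiLabeledGraph.intro {last k}).union M).lab x) := by
    rintro (x | x) ⟨h₁, h₂⟩
    · exact Fin.castSucc_ne_last i (Finset.mem_singleton.1 h₂)
    · exact h.last_notMem x h₁
  have hne := Fin.castSucc_ne_last i
  refine ⟨_, h.fuse_of_notMem (fun _ _ => Iff.rfl) (fun _ => Iff.rfl) (fun _ => rfl) rfl
    (fun x y => ?_) (fun x => ?_) (fun x => ?_) (fun l => ?_) ?_ hi⟩
  · refine (MultiLabeledGraph.join_adj hd (Sum.inr x) (Sum.inr y)).trans ?_
    have h₁ := h.last_notMem x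
    have h₂ := h.last_notMem y
    change M.graph.Adj x y ∨ last k ∈ M.lab x ∧ _ ∨ last k ∈ M.lab y ∧ _ ↔ _
    grind
  · refine (MultiLabeledGraph.join_adj hd (Sum.inl ()) (Sum.inr x)).trans ?_
    have h₁ := h.last_notMem x
    change ((⊥ : SimpleGraph Unit) ⊕g M.graph).Adj (Sum.inl ()) (Sum.inr x) ∨
      last k ∈ ({last k} : Finset _) ∧ castSucc i ∈ M.lab x ∨ last k ∈ M.lab x ∧ _ ↔ _
    simp [h₁]
  · exact relabelSet_addSet_relabelSet_of_notMem (h.last_notMem x)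
  · rw [← FuseExpr.mem_partners]
    exact mem_relabelSet_addSet_singleton l
  · exact last_notMem_relabelSet_addSet_singleton hne (FuseExpr.last_notMem_partners i I)

/-! ### Correctness of the translation. -/

namespace FuseExpr

variable {a b : FuseExpr k}

/-- The translation of `φ` is well-formed and represents `A`, with the labels in `S` still to be
fused. -/
def Translates (S : List (Fin k)) (A : LabeledGraph k) (φ : FuseExpr k) : Prop :=
  (∀ e ∈ φ.toMulti, e.WellFormed) ∧ Represents S A φ.pending (MultiExpr.evalOption φ.toMulti)

theorem translates_intro (hi : i ∈ S) : Translates S (.intro i) (intro i) := by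
  refine ⟨by simp [toMulti], _, RepresentsBy.single hi⟩

theorem Translates.union (ha : Translates S A a) (hb : Translates S B b) :
    Translates S (A.union B) (union a b) := by
  obtain ⟨wa, ra⟩ := ha
  obtain ⟨wb, rb⟩ := hb
  have h := ra.union rb
  unfold Translates
  rw [toMulti, pending]
  cases ea : a.toMulti with
  | none =>
    rw [ea] at h
    refine ⟨by simpa using wb, ?_⟩
    obtain ⟨f, h⟩ := h
    exact ⟨_, h.congr_right (Equiv.emptySum Empty _).symm (fun x y => Iff.rfl) (fun _ => rfl)⟩
  | some x =>
    cases eb : b.toMulti with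
    | none =>
      rw [ea, eb] at h
      refine ⟨by simpa [ea] using wa, ?_⟩
      obtain ⟨f, h⟩ := h
      exact ⟨_, h.congr_right (Equiv.sumEmpty _ Empty).symm (fun x y => Iff.rfl) (fun _ => rfl)⟩
    | some y =>
      rw [ea, eb] at h
      simp only [ea, eb, Option.mem_some_iff, forall_eq'] at wa wb
      refine ⟨?_, h⟩
      simpa [MultiExpr.WellFormed] using And.intro wa wb

theorem Translates.join (ha : Translates S A a) (hij : i ≠ j) :
    Translates S (A.join i j) (join i j a) := by
  obtain ⟨wa, ra⟩ := ha
  unfold Translates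
  rw [toMulti, pending]
  by_cases hi : i ∈ entries a.pending <;> by_cases hj : j ∈ entries a.pending
  · simp only [hi, hj, if_true, and_self, Option.map_id']
    obtain ⟨f, ra⟩ := ra
    exact ⟨wa, f, ra.join_of_mem_of_mem (LabeledGraph.join_adj hij) hi hj hij⟩
  · have h := ra.join_of_mem_of_notMem hij hi hj
    simp only [hi, hj, if_true, if_false, and_false]
    cases ea : a.toMulti with
    | none => rw [ea] at h; exact ⟨by simp, h.congr_empty (inferInstanceAs (IsEmpty Empty))⟩
    | some e =>
      rw [ea] at h wa
      simp only [Option.mem_some_iff, forall_eq'] at wa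
      refine ⟨by simp [MultiExpr.WellFormed, wa, hij.symm], ?_⟩
      simpa [MultiExpr.evalOption, MultiExpr.eval] using h
  · have h := ra.join_of_notMem_of_mem hij hi hj
    simp only [hi, hj, if_true, if_false, false_and]
    cases ea : a.toMulti with
    | none => rw [ea] at h; exact ⟨by simp, h.congr_empty (inferInstanceAs (IsEmpty Empty))⟩
    | some e =>
      rw [ea] at h wa
      simp only [Option.mem_some_iff, forall_eq'] at wa
      refine ⟨by simp [MultiExpr.WellFormed, wa, hij], ?_⟩
      simpa [MultiExpr.evalOption, MultiExpr.eval] using h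
  · have h := ra.join_of_notMem_of_notMem hij hi hj
    simp only [hi, hj, if_false, and_false]
    cases ea : a.toMulti with
    | none => rw [ea] at h; exact ⟨by simp, h.2.congr_empty (inferInstanceAs (IsEmpty Empty))⟩
    | some e =>
      rw [ea] at h wa
      simp only [Option.mem_some_iff, forall_eq'] at wa
      refine ⟨?_, h.2⟩
      simp only [Option.map_some, Option.mem_some_iff, forall_eq']
      exact ⟨by simpa using hij, h.1, wa⟩

theorem Translates.relabel (ha : Translates (relabelPreimage i j S) A a) (hij : i ≠ j) :
    Translates S (A.relabel i j) (relabel i j a) := by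
  obtain ⟨wa, ra⟩ := ha
  have h := ra.relabel hij
  unfold Translates
  rw [toMulti, pending]
  cases ea : a.toMulti with
  | none => rw [ea] at h; exact ⟨by simp, h.congr_empty (inferInstanceAs (IsEmpty Empty))⟩
  | some e =>
    rw [ea] at h wa
    simp only [Option.mem_some_iff, forall_eq'] at wa
    refine ⟨by simp [MultiExpr.WellFormed, wa], ?_⟩
    simpa [MultiExpr.evalOption, MultiExpr.eval] using h

theorem Translates.fuse_of_notMem (ha : Translates (i :: S) A a) (hi : i ∉ S) :
    Translates S (A.fuse i) (fuse i a) := by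
  obtain ⟨wa, ra⟩ := ha
  have h := ra.fuse_of_notMem hi
  unfold Translates
  rw [toMulti, pending]
  simp only [Option.mem_some_iff, forall_eq', MultiExpr.WellFormed, MultiExpr.evalOption,
    MultiExpr.eval, eval_addPartners, List.toFinset_cons, List.toFinset_nil, List.nodup_cons,
    List.not_mem_nil, not_false_eq_true, List.nodup_nil, and_self, true_and, insert_empty_eq]
  have hne := Fin.castSucc_ne_last i
  cases ea : a.toMulti with
  | none =>
    rw [ea] at h
    constructor
    · apply wellFormed_addPartners
      simp [MultiExpr.WellFormed, hne.symm, MultiExpr.eval, MultiLabeledGraph.intro, hne]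
    · obtain ⟨f, h⟩ := h
      refine ⟨_, h.congr_right (Equiv.sumEmpty Unit Empty).symm ?_ (fun _ => rfl)⟩
      rintro ⟨⟩ ⟨⟩
      exact iff_of_false (SimpleGraph.irrefl _) (SimpleGraph.irrefl _)
  | some e =>
    rw [ea] at h wa ra
    simp only [Option.mem_some_iff, forall_eq'] at wa
    refine ⟨?_, h⟩
    apply wellFormed_addPartners
    simp only [MultiExpr.WellFormed, List.nodup_nil, true_and, ne_eq, hne.symm,
      not_false_eq_true, List.cons_ne_nil, List.nodup_cons, List.not_mem_nil, and_self, wa,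
      and_true]
    obtain ⟨f, ra⟩ := ra
    rintro (x | x) ⟨h₁, h₂⟩
    · exact hne (Finset.mem_singleton.1 h₂)
    · exact ra.last_notMem x h₁

theorem Translates.fuse_of_mem (ha : Translates S A a) (hi : i ∈ S) (ho : ∃ v, A.lab v = i) :
    Translates S (A.fuse i) a := by
  obtain ⟨wa, f, ra⟩ := ha
  exact ⟨wa, _, ra.fuse_of_mem (fun _ _ => Iff.rfl) (fun _ => Iff.rfl) (fun _ => rfl) rfl hi ho⟩

/-- Fusing a single vertex only renames it to `none`; this justifies the fuse inserted by
`normalize` at a leaf. -/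
theorem translates_fuse_intro (hi : i ∉ S) : Translates S (.intro i) (fuse i (intro i)) := by
  obtain ⟨w, f, r⟩ := (translates_intro (List.mem_cons_self (a := i) (l := S))).fuse_of_notMem hi
  have : IsEmpty {v : (LabeledGraph.intro i).V // (LabeledGraph.intro i).lab v ≠ i} :=
    ⟨fun v => v.2 rfl⟩
  let e : Option {v : (LabeledGraph.intro i).V // (LabeledGraph.intro i).lab v ≠ i} ≃ Unit :=
    Equiv.ofUnique _ Unit
  refine ⟨w, _, r.congr_left e ?_ ?_⟩
  · rintro (_ | x) (_ | y)
    · exact Iff.rfl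
    · exact isEmptyElim y
    · exact isEmptyElim x
    · exact isEmptyElim x
  · rintro (_ | x)
    · rfl
    · exact isEmptyElim x

theorem translates_normalize (φ : FuseExpr k) (S : List (Fin k)) (hφ : φ.WellFormed) :
    Translates S φ.eval (normalize S φ) := by
  induction φ generalizing S with
  | intro i =>
    rw [normalize]
    split_ifs with hi
    · exact translates_intro hi
    · exact translates_fuse_intro hi
  | union a b iha ihb => exact (iha S hφ.1).union (ihb S hφ.2)
  | join i j a ih => exact (ih S hφ.2).join hφ.1
  | relabel i j a ih => exact (ih _ hφ.2).relabel hφ.1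
  | fuse i a ih =>
    rw [normalize]
    split_ifs with hi
    · exact (ih S hφ.2).fuse_of_mem hi hφ.1
    · exact (ih (i :: S) hφ.2).fuse_of_notMem hi

theorem nonempty_eval (φ : FuseExpr k) : Nonempty φ.eval.V := by
  induction φ with
  | intro i => exact ⟨()⟩
  | union a b iha ihb => exact iha.map Sum.inl
  | join i j a ih => exact ih
  | relabel i j a ih => exact ih
  | fuse i a ih => exact ⟨none⟩

/-- With nothing left to fuse, `range` makes the injection `f` surjective, and promises no longer
matter. A missing expression is impossible since the graph created by `φ` is nonempty. -/
theorem exists_toMulti_isExprOf {V : Type*} (φ : FuseExpr k) (G : SimpleGraph V)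
    (h : φ.IsExprOf G) : ∃ ψ, (normalize [] φ).toMulti = some ψ ∧ ψ.IsExprOf G := by
  obtain ⟨hφ, ⟨g⟩⟩ := h
  obtain ⟨w, r⟩ := translates_normalize φ [] hφ
  cases e : (normalize [] φ).toMulti with
  | none =>
    rw [e] at r
    obtain ⟨f, r⟩ := r
    obtain ⟨v⟩ := nonempty_eval φ
    obtain ⟨x, -⟩ := (r.range v).2 (by simp)
    exact x.elim
  | some ψ =>
    rw [e] at r
    obtain ⟨f, r⟩ := r
    have hf : Function.Bijective f := ⟨r.inj, fun v => (r.range v).2 (by simp)⟩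
    exact ⟨ψ, rfl, w _ e, ⟨RelIso.trans ⟨Equiv.ofBijective f hf, (r.adj _ _).symm⟩ g⟩⟩

end FuseExpr

end

/-! ### Loop rules for stack programs. -/

namespace StackProg

section

variable {K Γ : Type} [DecidableEq K]

theorem Runs.congr {p : StackProg K Γ} {s₁ s₁' s₂ s₂' : K → List Γ} {t₁ t₂ : ℕ}
    (h : Runs p s₁ s₁' t₁) (hs : s₁ = s₂) (hs' : s₁' = s₂') (ht : t₁ ≤ t₂) :
    Runs p s₂ s₂' t₂ :=
  hs ▸ hs' ▸ h.mono ht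

/-- Loop rule with an invariant indexed by the processed and the remaining part of a list; the last
update is the pop by the failing test. -/
theorem runs_loop_list {α : Type} {k : K} {c : Option Γ → Bool} {f : Option Γ → StackProg K Γ}
    (inv : List α → List α → K → List Γ) (l : List α) (T : ℕ)
    (hstep : ∀ pre x post, pre ++ x :: post = l → c (inv pre (x :: post) k).head? = true ∧
      Runs (f (inv pre (x :: post) k).head?)
        (Function.update (inv pre (x :: post)) k (inv pre (x :: post) k).tail)
        (inv (pre ++ [x]) post) T)
    (hexit : c (inv l [] k).head? = false) :
    Runs (loop k c f) (inv [] l) (Function.update (inv l []) k (inv l [] k).tail)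
      (l.length * (T + 1) + 1) := by
  suffices h : ∀ post pre, pre ++ post = l → Runs (loop k c f) (inv pre post)
      (Function.update (inv l []) k (inv l [] k).tail) (post.length * (T + 1) + 1) from
    h l [] rfl
  intro post
  induction post with
  | nil =>
    rintro pre rfl
    simp only [List.append_nil] at hexit ⊢
    exact (Runs.loop_exit hexit).mono (by simp)
  | cons x post ih =>
    intro pre hl
    obtain ⟨h₁, h₂⟩ := hstep pre x post hl
    refine (Runs.loop_step h₁ h₂ (ih (pre ++ [x]) (by simpa using hl))).mono ?_
    simp only [List.length_cons, Nat.add_mul]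
    omega

theorem runs_loop_count {k : K} {c : Option Γ → Bool} {f : Option Γ → StackProg K Γ}
    (inv : ℕ → ℕ → K → List Γ) (n T : ℕ)
    (hstep : ∀ i j, i + (j + 1) = n → c (inv i (j + 1) k).head? = true ∧
      Runs (f (inv i (j + 1) k).head?)
        (Function.update (inv i (j + 1)) k (inv i (j + 1) k).tail) (inv (i + 1) j) T)
    (hexit : c (inv n 0 k).head? = false) :
    Runs (loop k c f) (inv 0 n) (Function.update (inv n 0) k (inv n 0 k).tail)
      (n * (T + 1) + 1) := by
  have h := runs_loop_list (k := k) (c := c) (f := f)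
    (fun pre post : List Unit => inv pre.length post.length)
    (List.replicate n ()) T (fun pre x post e => ?_) (by simpa using hexit)
  · simpa using h
  · have := congrArg List.length e
    simp only [List.length_append, List.length_cons, List.length_replicate] at this
    simpa using hstep _ _ this

/-- Empty the stack `x`. -/
def drain (x : K) : StackProg K Γ :=
  loop x Option.isSome fun _ => skip

theorem runs_drain (x : K) (s : K → List Γ) :
    Runs (drain x) s (Function.update s x []) (2 * (s x).length + 1) := by
  have h := runs_loop_list (k := x) (c := Option.isSome) (f := fun _ => skip)
    (fun _ post => Function.update s x post) (s x) 1
    (fun pre y post _ => ⟨by simp, by simpa using Runs.skip _⟩) (by simp)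
  simp only [Function.update_eq_self, Function.update_self, List.tail_nil,
    Function.update_idem] at h
  exact h.mono (by omega)

/-- Move the contents of the stack `x` to `y`. -/
def move (x y : K) : StackProg K Γ :=
  loop x Option.isSome fun
    | some v => push y v
    | none => skip

theorem runs_move {x y : K} (hxy : x ≠ y) (s : K → List Γ) :
    Runs (move x y) s (Function.update (Function.update s x []) y ((s x).reverse ++ s y))
      (2 * (s x).length + 1) := by
  have h := runs_loop_list (k := x) (c := Option.isSome)
    (f := fun | some v => push y v | none => skip)
    (fun pre post => Function.update (Function.update s x post) y (pre.reverse ++ s y)) (s x) 1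
    (fun pre v post _ => ⟨by simp [hxy], by
      simp only [Function.update_of_ne hxy, Function.update_self, List.head?_cons, List.tail_cons]
      convert! Runs.push y v _ using 1
      funext z
      simp only [Function.update_apply]
      split_ifs <;> simp_all⟩) (by simp [hxy])
  convert! h.mono (T := 2 * (s x).length + 1) (by omega) using 1
  · funext z
    simp only [Function.update_apply]
    split_ifs <;> simp_all
  · funext z
    simp only [Function.update_apply]
    split_ifs <;> simp_all

end

end StackProg

/-! ### Programs on unary numbers. -/

open StackProg ExprSymbol

/-- The stacks of the machine. -/
inductive Reg where
  | inp | mid | d | r | f | out | a | b | kk | c | t | u | w | e | g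
  deriving DecidableEq

instance : Fintype Reg where
  elems := {.inp, .mid, .d, .r, .f, .out, .a, .b, .kk, .c, .t, .u, .w, .e, .g}
  complete x := by cases x <;> decide

/-- The programs of the machine. -/
abbrev Prog := StackProg Reg ExprSymbol

/-- The unary representation of a number without a separator. -/
abbrev ones (n : ℕ) : List ExprSymbol := List.replicate n one

/-- A list of numbers, each of them with a symbol in front of it. -/
def encodeNums (l : List ℕ) : List ExprSymbol :=
  l.flatMap fun n => ExprSymbol.join :: encodeNat n

namespace Prog

/-- Move a number in front of the stack `x` to the empty stack `y`. -/
def readNum (x y : Reg) : Prog :=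
  loop x (fun o => o = some one) fun _ => push y one

theorem runs_readNum {x y : Reg} (hxy : x ≠ y) {s : Reg → List ExprSymbol} {n : ℕ}
    {l : List ExprSymbol} (hx : s x = encodeNat n ++ l) (hy : s y = []) :
    Runs (readNum x y) s (Function.update (Function.update s x l) y (ones n)) (2 * n + 1) := by
  have h := runs_loop_count (k := x) (c := fun o => o = some one) (f := fun _ => push y one)
    (fun i j => Function.update (Function.update s x (ones j ++ sep :: l)) y (ones i)) n 1
    (fun i j e => by
      refine ⟨by simp [hxy, List.replicate_succ], ?_⟩
      convert! Runs.push y one _ using 1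
      funext z
      simp only [Function.update_apply]
      split_ifs <;> simp_all [List.replicate_succ]) (by simp [hxy])
  convert! h.mono (T := 2 * n + 1) (by omega) using 1
  · funext z
    simp only [Function.update_apply]
    split_ifs <;> simp_all [encodeNat]
  · funext z
    simp only [Function.update_apply]
    split_ifs <;> simp_all

/-- Push copies of the number on the stack `x` to the stack `y`. -/
def copyOnes (x y : Reg) : Prog :=
  seq (loop x Option.isSome fun _ => seq (push .t one) (push y one)) (move .t x)

theorem runs_copyOnes {x y : Reg} (hxy : x ≠ y) (hx : x ≠ .t) (hy : y ≠ .t)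
    {s : Reg → List ExprSymbol} {n : ℕ} (hsx : s x = ones n) (ht : s .t = []) :
    Runs (copyOnes x y) s (Function.update s y (ones n ++ s y)) (5 * n + 2) := by
  have h := runs_loop_count (k := x) (c := Option.isSome)
    (f := fun _ => seq (push .t one) (push y one))
    (fun i j => Function.update (Function.update (Function.update s x (ones j)) .t (ones i)) y
      (ones i ++ s y)) n 2
    (fun i j e => by
      refine ⟨by simp [hxy, hx, List.replicate_succ], ?_⟩
      convert! Runs.seq (Runs.push .t one _) (Runs.push y one _) using 1
      funext z
      simp only [Function.update_apply]
      split_ifs <;> simp_all [List.replicate_succ]) (by simp [hxy, hx])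
  have h' := h.seq (runs_move hx.symm _)
  convert! h'.mono (T := 5 * n + 2) _ using 1
  · funext z
    simp only [Function.update_apply]
    split_ifs <;> simp_all
  · funext z
    simp only [Function.update_apply]
    split_ifs <;> simp_all
  · simp [hx.symm, hy.symm, Function.update_apply]
    omega

/-- Push the number on the stack `x` to the stack `y`. -/
def emit (x y : Reg) : Prog :=
  seq (push y sep) (copyOnes x y)

theorem runs_emit {x y : Reg} (hxy : x ≠ y) (hx : x ≠ .t) (hy : y ≠ .t)
    {s : Reg → List ExprSymbol} {n : ℕ} (hsx : s x = ones n) (ht : s .t = []) :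
    Runs (emit x y) s (Function.update s y (encodeNat n ++ s y)) (5 * n + 3) := by
  have h := (Runs.push y sep s).seq (runs_copyOnes (n := n) hxy hx hy
    (by simp [hxy, hsx]) (by simp [hy.symm, ht]))
  convert! h.mono (T := 5 * n + 3) (by omega) using 1
  simp [encodeNat]

/-- Push the number on the stack `x` to the stack `y` in reverse, as an entry of a list. -/
def emitRev (x y : Reg) : Prog :=
  seq (push y .join) (seq (copyOnes x y) (push y sep))

/-- Entries are written reversed because they are collected on a stack that is later reversed by
`move`. -/
theorem runs_emitRev {x y : Reg} (hxy : x ≠ y) (hx : x ≠ .t) (hy : y ≠ .t)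
    {s : Reg → List ExprSymbol} {n : ℕ} (hsx : s x = ones n) (ht : s .t = []) :
    Runs (emitRev x y) s (Function.update s y ((encodeNums [n]).reverse ++ s y)) (5 * n + 4) := by
  have h := (Runs.push y .join s).seq ((runs_copyOnes (n := n) hxy hx hy
    (by simp [hxy, hsx]) (by simp [hy.symm, ht])).seq (Runs.push y sep _))
  convert! h.mono (T := 5 * n + 4) (by omega) using 1
  simp [encodeNat, encodeNums]

/-- Run `p` if the numbers on the stacks `x` and `y` are equal, and `q` otherwise. -/
def ifEq (x y : Reg) (p q : Prog) : Prog :=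
  seq (loop x Option.isSome fun _ => seq (push .t one) (popCase y fun
      | some _ => push .w one
      | none => push .e one))
    (seq (popCase y fun
      | some _ => seq (push y one) (push .e one)
      | none => skip)
    (seq (move .t x) (seq (move .w y)
      (popCase .e fun
        | some _ => seq (drain .e) q
        | none => p))))

/-- The stacks `s` with new contents of `x`, `y` and the stacks used for comparisons. -/
def eqState (s : Reg → List ExprSymbol) (x y : Reg) (nx ny nt nw ne : ℕ) (z : Reg) :
    List ExprSymbol :=
  if z = x then ones nx else if z = y then ones ny else if z = .t then ones nt
  else if z = .w then ones nw else if z = .e then ones ne else s z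

/-- Both numbers are consumed in parallel, with copies on `t` and `w` from which they are restored.
The stack `e` collects the marks that witness a difference: the surplus of `x`, or a single mark if
`y` is not exhausted. The time depends on the number on `x` only. -/
theorem runs_ifEq {x y : Reg} {p q : Prog} (hxy : x ≠ y) (hx : x ∉ [Reg.t, .w, .e])
    (hy : y ∉ [Reg.t, .w, .e]) {s s' : Reg → List ExprSymbol} {n m T : ℕ} (hsx : s x = ones n)
    (hsy : s y = ones m) (ht : s .t = []) (hw : s .w = []) (he : s .e = [])
    (h : Runs (if n = m then p else q) s s' T) :
    Runs (ifEq x y p q) s s' (T + 10 * n + 10) := by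
  simp only [List.mem_cons, List.not_mem_nil, or_false, not_or] at hx hy
  obtain ⟨hx₁, hx₂, hx₃⟩ := hx
  obtain ⟨hy₁, hy₂, hy₃⟩ := hy
  have hyx := Ne.symm hxy
  have hs : s = eqState s x y n m 0 0 0 := by
    funext z
    unfold eqState
    split_ifs <;> simp_all
  have ex : ∀ nx ny nt nw ne, eqState s x y nx ny nt nw ne x = ones nx := by simp [eqState]
  have ey : ∀ nx ny nt nw ne, eqState s x y nx ny nt nw ne y = ones ny := by simp [eqState, hyx]
  have et : ∀ nx ny nt nw ne, eqState s x y nx ny nt nw ne .t = ones nt := by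
    simp [eqState, Ne.symm hx₁, Ne.symm hy₁]
  have ew : ∀ nx ny nt nw ne, eqState s x y nx ny nt nw ne .w = ones nw := by
    simp [eqState, Ne.symm hx₂, Ne.symm hy₂]
  have ee : ∀ nx ny nt nw ne, eqState s x y nx ny nt nw ne .e = ones ne := by
    simp [eqState, Ne.symm hx₃, Ne.symm hy₃]
  have ux : ∀ nx ny nt nw ne l, Function.update (eqState s x y nx ny nt nw ne) x (ones l) =
      eqState s x y l ny nt nw ne := by
    intros; funext z; simp only [eqState, Function.update_apply]; grind
  have uy : ∀ nx ny nt nw ne l, Function.update (eqState s x y nx ny nt nw ne) y (ones l) =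
      eqState s x y nx l nt nw ne := by
    intros; funext z; simp only [eqState, Function.update_apply]; grind
  have ut : ∀ nx ny nt nw ne l, Function.update (eqState s x y nx ny nt nw ne) .t (ones l) =
      eqState s x y nx ny l nw ne := by
    intros; funext z; simp only [eqState, Function.update_apply]; grind
  have uw : ∀ nx ny nt nw ne l, Function.update (eqState s x y nx ny nt nw ne) .w (ones l) =
      eqState s x y nx ny nt l ne := by
    intros; funext z; simp only [eqState, Function.update_apply]; grind
  have ue : ∀ nx ny nt nw ne l, Function.update (eqState s x y nx ny nt nw ne) .e (ones l) =
      eqState s x y nx ny nt nw l := by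
    intros; funext z; simp only [eqState, Function.update_apply]; grind
  have hcons : ∀ l, one :: ones l = ones (l + 1) := fun _ => rfl
  have htail : ∀ l, (ones l).tail = ones (l - 1) := fun l => by cases l <;> rfl
  have hnil : [] = ones 0 := rfl
  have h₁ := runs_loop_count (k := x) (c := Option.isSome)
    (f := fun _ => seq (push .t one) (popCase y fun
      | some _ => push .w one
      | none => push .e one))
    -- Truncated subtractions cover both phases, before and after `y` runs empty.
    (fun i j => eqState s x y j (m - i) i (min i m) (i - m)) n 3
    (fun i j e => by
      refine ⟨by simp [ex, List.replicate_succ], ?_⟩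
      refine (Runs.push Reg.t one _).seq (t₂ := 2) (Runs.popCase ?_)
      simp only [ex, ux, et, ut, ey, uy, hcons, htail]
      rcases Nat.lt_or_ge i m with hi | hi
      · obtain ⟨l, hl⟩ : ∃ l, m - i = l + 1 := ⟨m - i - 1, by omega⟩
        rw [hl]
        refine (Runs.push Reg.w one _).congr rfl ?_ le_rfl
        simp only [ew, uw, hcons]
        congr 1 <;> omega
      · have hl : m - i = 0 := by omega
        rw [hl]
        refine (Runs.push Reg.e one _).congr rfl ?_ le_rfl
        simp only [ee, ue, hcons]
        congr 1 <;> omega)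
    (by simp [ex])
  -- The number `l` below counts the marks on `e` after testing `y`; it vanishes exactly when the
  -- numbers agree.
  simp only [ex, ux, htail] at h₁
  obtain ⟨l, hl, hl₀, hl₁⟩ : ∃ l, l ≤ n + 1 ∧ (l = 0 ↔ n = m) ∧
      l = n - m + (if n < m then 1 else 0) :=
    ⟨n - m + (if n < m then 1 else 0), by split_ifs <;> omega,
      by by_cases hnm : n < m <;> simp only [hnm, if_true, if_false] <;> omega, rfl⟩
  have h₂ : Runs (popCase y fun
      | some _ => seq (push y one) (push Reg.e one)
      | none => skip)
      (eqState s x y 0 (m - n) n (min n m) (n - m)) (eqState s x y 0 (m - n) n (min n m) l) 3 := by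
    refine Runs.popCase (t := 2) ?_
    simp only [ey, uy, htail]
    split_ifs at hl₁ with hnm
    · obtain ⟨j, hj⟩ : ∃ j, m - n = j + 1 := ⟨m - n - 1, by omega⟩
      rw [hj]
      refine Runs.congr (Runs.seq (Runs.push y one _) (Runs.push Reg.e one _)) rfl ?_ le_rfl
      simp only [ey, uy, ee, ue, hcons]
      congr 1; omega
    · have hj : m - n = 0 := by omega
      rw [hj]
      refine Runs.congr (Runs.skip _) rfl ?_ (by omega)
      congr 1; omega
  have h₃ : Runs (move Reg.t x) (eqState s x y 0 (m - n) n (min n m) l)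
      (eqState s x y n (m - n) 0 (min n m) l) (2 * n + 1) := by
    refine Runs.congr (runs_move (Ne.symm hx₁) _) rfl ?_ (by simp [et])
    simp only [ex, et, List.reverse_replicate, List.replicate_zero, List.append_nil]
    rw [hnil, ut, ux]
  have h₄ : Runs (move Reg.w y) (eqState s x y n (m - n) 0 (min n m) l)
      (eqState s x y n m 0 0 l) (2 * n + 1) := by
    refine Runs.congr (runs_move (Ne.symm hy₂) _) rfl ?_ (by simp [ew])
    simp only [ey, ew, List.reverse_replicate, ← List.replicate_add]
    rw [hnil, uw, uy]
    congr 1; omega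
  have h₅ : Runs (popCase Reg.e fun
        | some _ => seq (drain .e) q
        | none => p) (eqState s x y n m 0 0 l) s' (T + 2 * n + 2) := by
    refine Runs.popCase (t := T + 2 * n + 1) ?_
    simp only [ee, ue, htail]
    cases l with
    | zero =>
      rw [if_pos (by omega)] at h
      exact h.congr hs rfl (by omega)
    | succ l =>
      rw [if_neg (by omega)] at h
      refine ((runs_drain Reg.e _).seq (h.congr ?_ rfl le_rfl)).mono ?_
      · rw [hnil, ue]
        exact hs
      · simp only [ee, List.length_replicate]
        omega
  exact (h₁.seq (h₂.seq (h₃.seq (h₄.seq h₅)))).congr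
    (by simp only [Nat.sub_zero, Nat.zero_min, Nat.zero_sub]; exact hs.symm) rfl (by omega)

/-! ### Bookkeeping for temporary stacks. -/

/-- The stacks for temporary use. -/
def scratch : List Reg := [.c, .t, .u, .w, .e, .g]

/-- The stacks `s`, where those for temporary use are empty except for the stacks `c`, `u`, `g`
with the given contents. -/
def withScratch (s : Reg → List ExprSymbol) (c u g : List ExprSymbol) :
    Reg → List ExprSymbol
  | .c => c
  | .u => u
  | .g => g
  | .t => []
  | .w => []
  | .e => []
  | z => s z

section

variable {s : Reg → List ExprSymbol} {c u g : List ExprSymbol} {x y : Reg}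

theorem withScratch_of_notMem (hx : x ∉ scratch) : withScratch s c u g x = s x := by
  cases x <;> first | rfl | exact absurd (by decide) hx

theorem update_withScratch_of_notMem (hx : x ∉ scratch) (l : List ExprSymbol) :
    Function.update (withScratch s c u g) x l = withScratch (Function.update s x l) c u g := by
  funext z
  by_cases h : z = x
  · subst h
    rw [withScratch_of_notMem hx, Function.update_self, Function.update_self]
  · rw [Function.update_of_ne h]
    cases z <;> simp [withScratch, Function.update_of_ne h]

theorem update_withScratch_c (l : List ExprSymbol) :
    Function.update (withScratch s c u g) .c l = withScratch s l u g := by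
  funext z
  cases z <;> simp [withScratch]

theorem update_withScratch_u (l : List ExprSymbol) :
    Function.update (withScratch s c u g) .u l = withScratch s c l g := by
  funext z
  cases z <;> simp [withScratch]

theorem update_withScratch_g (l : List ExprSymbol) :
    Function.update (withScratch s c u g) .g l = withScratch s c u l := by
  funext z
  cases z <;> simp [withScratch]

theorem ne_of_notMem_scratch {z : Reg} (hx : x ∉ scratch) (hz : z ∈ scratch) : x ≠ z :=
  fun h => hx (h ▸ hz)

theorem runs_readNum_scratch (hx : x ∉ scratch) {n : ℕ} {l : List ExprSymbol}
    (hsx : s x = encodeNat n ++ l) :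
    Runs (readNum x .c) (withScratch s [] u g) (withScratch (Function.update s x l) (ones n) u g)
      (2 * n + 1) := by
  refine (runs_readNum (n := n) (l := l) (ne_of_notMem_scratch hx (by decide)) ?_ rfl).congr rfl
    ?_ le_rfl
  · rwa [withScratch_of_notMem hx]
  · rw [update_withScratch_of_notMem hx, update_withScratch_c]

theorem runs_drain_scratch : Runs (drain .c) (withScratch s c u g) (withScratch s [] u g)
    (2 * c.length + 1) :=
  (runs_drain Reg.c _).congr rfl (update_withScratch_c _) le_rfl

theorem runs_emitRev_c (n : ℕ) : Runs (emitRev .c .u) (withScratch s (ones n) u g)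
    (withScratch s (ones n) ((encodeNums [n]).reverse ++ u) g) (5 * n + 4) :=
  (runs_emitRev (n := n) (by decide) (by decide) (by decide) rfl rfl).congr rfl
    (update_withScratch_u _) le_rfl

theorem runs_emitRev_scratch (hx : x ∉ scratch) {n : ℕ} (hsx : s x = ones n) :
    Runs (emitRev x .u) (withScratch s c u g)
      (withScratch s c ((encodeNums [n]).reverse ++ u) g) (5 * n + 4) :=
  (runs_emitRev (n := n) (ne_of_notMem_scratch hx (by decide))
    (ne_of_notMem_scratch hx (by decide)) (by decide) (by rwa [withScratch_of_notMem hx])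
    rfl).congr rfl (update_withScratch_u _) le_rfl

theorem runs_emit_scratch (hxy : x ≠ y) (hx : x ∉ scratch) (hy : y ∉ scratch) {n : ℕ}
    (hsx : s x = ones n) :
    Runs (emit x y) (withScratch s c u g)
      (withScratch (Function.update s y (encodeNat n ++ s y)) c u g) (5 * n + 3) := by
  refine (runs_emit (n := n) hxy (ne_of_notMem_scratch hx (by decide))
    (ne_of_notMem_scratch hy (by decide)) (by rwa [withScratch_of_notMem hx]) rfl).congr rfl
    ?_ le_rfl
  rw [update_withScratch_of_notMem hy, withScratch_of_notMem hy]

theorem runs_push_scratch (hy : y ∉ scratch) (v : ExprSymbol) :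
    Runs (push y v) (withScratch s c u g)
      (withScratch (Function.update s y (v :: s y)) c u g) 1 := by
  refine (Runs.push y v _).congr rfl ?_ le_rfl
  rw [update_withScratch_of_notMem hy, withScratch_of_notMem hy]

theorem not_mem_of_notMem_scratch (hx : x ∉ scratch) : x ∉ [Reg.t, .w, .e] :=
  fun h => hx (by revert h; cases x <;> decide)

theorem runs_ifEq_c {p q : Prog} (hx : x ∉ scratch) {s' : Reg → List ExprSymbol}
    {n m T : ℕ} (hsx : s x = ones n)
    (h : Runs (if n = m then p else q) (withScratch s (ones m) u g) s' T) :
    Runs (ifEq x .c p q) (withScratch s (ones m) u g) s' (T + 10 * n + 10) :=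
  runs_ifEq (m := m) (ne_of_notMem_scratch hx (by decide)) (not_mem_of_notMem_scratch hx)
    (by decide) (by rwa [withScratch_of_notMem hx]) rfl rfl rfl rfl h

theorem runs_ifEq_scratch {p q : Prog} (hx : x ∉ scratch) (hy : y ∉ scratch) (hxy : x ≠ y)
    {s' : Reg → List ExprSymbol} {n m T : ℕ} (hsx : s x = ones n) (hsy : s y = ones m)
    (h : Runs (if n = m then p else q) (withScratch s c u g) s' T) :
    Runs (ifEq x y p q) (withScratch s c u g) s' (T + 10 * n + 10) :=
  runs_ifEq (m := m) hxy (not_mem_of_notMem_scratch hx) (not_mem_of_notMem_scratch hy)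
    (by rwa [withScratch_of_notMem hx]) (by rwa [withScratch_of_notMem hy]) rfl rfl rfl h

/-- Run the body for every entry of the list in front of the stack `x` and put what it leaves on
the stack `u` in place of the list. -/
def forEntries (x : Reg) (body : Prog) : Prog :=
  seq (loop x (fun o => o = some .join) fun _ => body) (seq (push x close) (move .u x))

/-- The loop test eats the marker `.join`, so the body starts at `enc n`; the failing test eats
`close`, which is pushed back. Results accumulate reversed on `u`, and moving them back restores
their order. The stack `g` is a free accumulator. -/
theorem runs_forEntries {α : Type} {body : Prog} (hx : x ∉ scratch)
    (enc : α → List ExprSymbol) (inv : List α → Reg → List ExprSymbol)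
    (res gs : List α → List ExprSymbol) (l : List α) (D : List ExprSymbol) (T : ℕ)
    (hres : res [] = [])
    (hstep : ∀ pre n post, pre ++ n :: post = l →
      Runs body
        (withScratch (Function.update (inv pre) x
          (enc n ++ (post.flatMap (fun n => .join :: enc n) ++ close :: D)))
          [] (res pre).reverse (gs pre))
        (withScratch (Function.update (inv (pre ++ [n])) x
          (post.flatMap (fun n => .join :: enc n) ++ close :: D))
          [] (res (pre ++ [n])).reverse (gs (pre ++ [n]))) T) :
    Runs (forEntries x body)
      (withScratch (Function.update (inv []) x
        (l.flatMap (fun n => .join :: enc n) ++ close :: D)) [] [] (gs []))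
      (withScratch (Function.update (inv l) x (res l ++ close :: D)) [] [] (gs l))
      (l.length * (T + 1) + 2 * (res l).length + 3) := by
  have hu : x ≠ .u := ne_of_notMem_scratch hx (by decide)
  have h₁ := runs_loop_list (k := x) (c := fun o => o = some .join) (f := fun _ => body)
    (fun pre post => withScratch (Function.update (inv pre) x
      (post.flatMap (fun n => .join :: enc n) ++ close :: D)) [] (res pre).reverse (gs pre)) l
    T (fun pre n post e => by
      rw [withScratch_of_notMem hx, Function.update_self, update_withScratch_of_notMem hx,
        Function.update_idem]
      exact ⟨by simp, by simpa using hstep pre n post e⟩)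
    (by rw [withScratch_of_notMem hx]; simp)
  refine (h₁.seq ((Runs.push x close _).seq (runs_move (Ne.symm hu) _))).congr ?_ ?_ ?_
  · rw [hres]; rfl
  · simp only [update_withScratch_of_notMem hx, withScratch_of_notMem hx, update_withScratch_u,
      Function.update_idem, Function.update_self, List.flatMap_nil, List.nil_append,
      List.tail_cons]
    simp [withScratch]
  · simp only [update_withScratch_of_notMem hx]
    simp only [withScratch, List.length_reverse]
    omega

end

end Prog

/-! ### Programs on lists of numbers. -/

namespace Prog

theorem length_encodeNums_le {l : List ℕ} {N : ℕ} (hN : ∀ n ∈ l, n ≤ N) :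
    (encodeNums l).length ≤ l.length * (N + 2) := by
  induction l with
  | nil => simp [encodeNums]
  | cons n l ih =>
    have h₁ := ih fun m hm => hN m (List.mem_cons_of_mem _ hm)
    have h₂ := hN n List.mem_cons_self
    simp only [encodeNums, List.flatMap_cons, List.length_append, List.length_cons, encodeNat,
      List.length_replicate, List.length_nil, Nat.add_mul] at h₁ ⊢
    omega

theorem encodeNums_append (l l' : List ℕ) : encodeNums (l ++ l') = encodeNums l ++ encodeNums l' :=
  List.flatMap_append

/-- A bound for the time needed to go through a list of `m` numbers of size at most `N`. -/
def passTime (m N : ℕ) : ℕ := (m + 1) * (40 * (N + 1))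

/-- The factor `40 * (N + 1)` per entry pays for the body and for moving the result back, and still
leaves the `2 * m` and the constant needed by callers to clear up. -/
theorem le_passTime {t m N L : ℕ} (ht : t ≤ 30 * N + 30) (hL : L ≤ m * (N + 2)) :
    m * (t + 1) + 2 * L + 2 * m + 8 ≤ passTime m N := by
  unfold passTime
  nlinarith [Nat.mul_le_mul_left m ht]

variable {s s' : Reg → List ExprSymbol} {x y z : Reg} {n N T : ℕ} {l : List ℕ}
  {D g : List ExprSymbol}

/-- Run the body for every number in the list in front of the stack `x`, with the number on the
stack `c`. -/
def forList (x : Reg) (body : Prog) : Prog :=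
  forEntries x (seq (readNum x .c) (seq body (drain .c)))

/-- The amount subtracted from `passTime` lets programs such as `ifMem` and `dropList` finish within
one `passTime`. -/
theorem runs_forList {body : Prog} (hx : x ∉ scratch) (hsx : s x = encodeNums l ++ close :: D)
    (hN : ∀ m ∈ l, m ≤ N) (res : List ℕ → List ℕ) (gs : List ℕ → List ExprSymbol)
    (hres : res [] = []) (hT : T ≤ 26 * N + 28) (hlen : (res l).length ≤ l.length)
    (hresN : ∀ m ∈ res l, m ≤ N)
    (hstep : ∀ pre m rest, m ≤ N →
      Runs body
        (withScratch (Function.update s x rest) (ones m) (encodeNums (res pre)).reverse (gs pre))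
        (withScratch (Function.update s x rest) (ones m) (encodeNums (res (pre ++ [m]))).reverse
          (gs (pre ++ [m]))) T) :
    Runs (forList x body) (withScratch s [] [] (gs []))
      (withScratch (Function.update s x (encodeNums (res l) ++ close :: D)) [] [] (gs l))
      (passTime l.length N - 2 * l.length - 5) := by
  have h := runs_forEntries (body := seq (readNum x .c) (seq body (drain .c))) hx encodeNat
    (fun _ => s) (fun pre => encodeNums (res pre)) gs l D (T + 4 * N + 2)
    (by simp [hres, encodeNums])
    (fun pre m post e => by
      have hm : m ≤ N := hN m (by rw [← e]; simp)
      refine ((runs_readNum_scratch (n := m) hx (Function.update_self _ _ _)).seq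
        (((hstep pre m _ hm).congr (by rw [Function.update_idem]) rfl le_rfl).seq
          runs_drain_scratch)).mono ?_
      simp only [List.length_replicate]
      omega)
  refine h.congr ?_ rfl ?_
  · congr 1
    rw [Function.update_eq_self_iff, hsx]
    rfl
  · have h₁ : T + 4 * N + 2 ≤ 30 * N + 30 := by omega
    have h₂ : (encodeNums (res l)).length ≤ l.length * (N + 2) :=
      (length_encodeNums_le hresN).trans (Nat.mul_le_mul_right _ hlen)
    have := le_passTime h₁ h₂
    omega

/-- Run `p` if the number on the stack `y` is in the list in front of the stack `x`, and `q`
otherwise. -/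
def ifMem (x y : Reg) (p q : Prog) : Prog :=
  seq (forList x (seq (emitRev .c .u) (ifEq y .c (push .g one) skip)))
    (popCase .g fun
      | some _ => seq (drain .g) p
      | none => q)

theorem runs_ifMem {p q : Prog} (hxy : x ≠ y) (hx : x ∉ scratch) (hy : y ∉ scratch)
    (hsx : s x = encodeNums l ++ close :: D) (hsy : s y = ones n) (hn : n ≤ N)
    (hN : ∀ m ∈ l, m ≤ N) (h : Runs (if n ∈ l then p else q) (withScratch s [] [] []) s' T) :
    Runs (ifMem x y p q) (withScratch s [] [] []) s' (T + passTime l.length N) := by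
  have h₁ := runs_forList (body := seq (emitRev .c .u) (ifEq y .c (push .g one) skip))
    -- The list is rewritten unchanged, while `g` receives one mark per occurrence of `n`.
    hx hsx hN id (fun pre => ones (pre.count n)) (T := 15 * N + 15) rfl (by omega) le_rfl hN
    (fun pre m rest hm => by
      refine ((runs_emitRev_c m).seq (runs_ifEq_c (n := n) (T := 1) hy ?_ ?_)).mono (by omega)
      · rwa [Function.update_of_ne hxy.symm]
      · split_ifs with hnm
        · refine (Runs.push Reg.g one _).congr rfl ?_ le_rfl
          subst hnm
          rw [update_withScratch_g]
          simp [encodeNums_append, withScratch, List.replicate_succ]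
        · refine (Runs.skip _).congr rfl ?_ le_rfl
          simp [encodeNums_append, Ne.symm hnm])
  have h₂ : Runs (popCase Reg.g fun
      | some _ => seq (drain .g) p
      | none => q) (withScratch s [] [] (ones (l.count n))) s' (T + 2 * l.length + 2) := by
    refine Runs.popCase (t := T + 2 * l.length + 1) ?_
    have := List.count_le_length (a := n) (l := l)
    rw [update_withScratch_g]
    by_cases hm : n ∈ l
    · rw [if_pos hm] at h
      have := List.count_pos_iff.2 hm
      obtain ⟨j, hj⟩ : ∃ j, l.count n = j + 1 := ⟨l.count n - 1, by omega⟩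
      simp only [withScratch, hj, List.replicate_succ, List.head?_cons, List.tail_cons]
      refine ((runs_drain Reg.g _).seq (h.congr ?_ rfl le_rfl)).mono ?_
      · rw [update_withScratch_g]
      · simp only [withScratch, List.length_replicate]
        omega
    · rw [if_neg hm] at h
      simp only [withScratch, List.count_eq_zero_of_not_mem hm, List.replicate_zero,
        List.head?_nil, List.tail_nil]
      exact h.mono (by omega)
  refine (h₁.seq (h₂.congr ?_ rfl le_rfl)).mono ?_
  · congr 1
    rw [eq_comm, Function.update_eq_self_iff, hsx]
    rfl
  · have : 2 * l.length + 7 ≤ passTime l.length N := by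
      unfold passTime
      nlinarith
    omega

/-- Remove the number on the stack `y` from the list in front of the stack `x`. -/
def removeAll (x y : Reg) : Prog :=
  forList x (ifEq y .c skip (emitRev .c .u))

theorem runs_removeAll (hxy : x ≠ y) (hx : x ∉ scratch) (hy : y ∉ scratch)
    (hsx : s x = encodeNums l ++ close :: D) (hsy : s y = ones n) (hn : n ≤ N)
    (hN : ∀ m ∈ l, m ≤ N) :
    Runs (removeAll x y) (withScratch s [] [] [])
      (withScratch (Function.update s x (encodeNums (l.filter (· ≠ n)) ++ close :: D)) [] [] [])
      (passTime l.length N) := by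
  refine (runs_forList hx hsx hN (fun l => l.filter (· ≠ n)) (fun _ => []) (T := 15 * N + 15) rfl
    (by omega) (List.length_filter_le _ _) (fun m hm => hN m (List.mem_of_mem_filter hm))
    (fun pre m rest hm => ?_)).mono (by omega)
  refine (runs_ifEq_c (n := n) (T := 5 * m + 5) hy ?_ ?_).mono (by omega)
  · rwa [Function.update_of_ne hxy.symm]
  · split_ifs with hnm
    · refine (Runs.skip _).congr rfl ?_ (by omega)
      simp [hnm]
    · refine (runs_emitRev_c m).congr rfl ?_ (by omega)
      simp [encodeNums_append, Ne.symm hnm]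

/-- In the list in front of the stack `x`, replace the number on the stack `y` by the number on
the stack `z`. -/
def replaceAll (x y z : Reg) : Prog :=
  forList x (ifEq y .c (emitRev z .u) (emitRev .c .u))

theorem runs_replaceAll {n' : ℕ} (hxy : x ≠ y) (hxz : x ≠ z) (hx : x ∉ scratch)
    (hy : y ∉ scratch) (hz : z ∉ scratch) (hsx : s x = encodeNums l ++ close :: D)
    (hsy : s y = ones n) (hsz : s z = ones n') (hn : n ≤ N) (hn' : n' ≤ N)
    (hN : ∀ m ∈ l, m ≤ N) :
    Runs (replaceAll x y z) (withScratch s [] [] [])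
      (withScratch (Function.update s x
        (encodeNums (l.map fun m => if m = n then n' else m) ++ close :: D)) [] [] [])
      (passTime l.length N) := by
  refine (runs_forList hx hsx hN (fun l => l.map fun m => if m = n then n' else m) (fun _ => [])
    (T := 15 * N + 15) rfl (by omega) (by simp) (fun m hm => ?_)
    (fun pre m rest hm => ?_)).mono (by omega)
  · obtain ⟨m', hm', rfl⟩ := List.mem_map.1 hm
    split_ifs
    · exact hn'
    · exact hN _ hm'
  refine (runs_ifEq_c (n := n) (T := 5 * N + 4) hy ?_ ?_).mono (by omega)
  · rwa [Function.update_of_ne hxy.symm]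
  · split_ifs with hnm
    · refine (runs_emitRev_scratch (n := n') hz ?_).congr rfl ?_ (by omega)
      · rwa [Function.update_of_ne hxz.symm]
      · simp [encodeNums_append, hnm]
    · refine (runs_emitRev_c m).congr rfl ?_ (by omega)
      simp [encodeNums_append, Ne.symm hnm]

/-- Remove the list in front of the stack `x`. -/
def dropList (x : Reg) : Prog :=
  seq (forList x skip) (popCase x fun _ => skip)

theorem runs_dropList (hx : x ∉ scratch) (hsx : s x = encodeNums l ++ close :: D)
    (hN : ∀ m ∈ l, m ≤ N) :
    Runs (dropList x) (withScratch s [] [] []) (withScratch (Function.update s x D) [] [] [])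
      (passTime l.length N) := by
  have h := runs_forList (body := skip) hx hsx hN (fun _ => []) (fun _ => []) (T := 1) rfl
    (by omega) (by simp) (by simp) (fun pre m rest hm => Runs.skip _)
  refine (h.seq (Runs.popCase (Runs.skip _))).congr rfl ?_ ?_
  · simp only [update_withScratch_of_notMem hx, withScratch_of_notMem hx, Function.update_idem,
      Function.update_self]
    rfl
  · have : 2 * l.length + 7 ≤ passTime l.length N := by
      unfold passTime
      nlinarith
    omega

theorem runs_emitRev_g (u g : List ExprSymbol) (n : ℕ) :
    Runs (emitRev .c .g) (withScratch s (ones n) u g)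
      (withScratch s (ones n) u ((encodeNums [n]).reverse ++ g)) (5 * n + 4) :=
  (runs_emitRev (n := n) (by decide) (by decide) (by decide) rfl rfl).congr rfl
    (update_withScratch_g _) le_rfl

theorem runs_move_g (hx : x ∉ scratch) (g : List ExprSymbol) :
    Runs (move .g x) (withScratch s [] [] g)
      (withScratch (Function.update s x (g.reverse ++ s x)) [] [] []) (2 * g.length + 1) := by
  refine (runs_move (ne_of_notMem_scratch hx (by decide)).symm _).congr rfl ?_ le_rfl
  rw [update_withScratch_g, update_withScratch_of_notMem hx, withScratch_of_notMem hx]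
  rfl

/-- Duplicate the list in front of the stack `x`. -/
def dupList (x : Reg) : Prog :=
  seq (forList x (seq (emitRev .c .u) (emitRev .c .g))) (seq (push x close) (move .g x))

theorem length_encodeNums_le_passTime (hN : ∀ m ∈ l, m ≤ N) :
    2 * (encodeNums l).length + 2 ≤ passTime l.length N := by
  have := length_encodeNums_le hN
  unfold passTime
  nlinarith

theorem runs_dupList (hx : x ∉ scratch) (hsx : s x = encodeNums l ++ close :: D)
    (hN : ∀ m ∈ l, m ≤ N) :
    Runs (dupList x) (withScratch s [] [] []) (withScratch (Function.update s x
      (encodeNums l ++ close :: (encodeNums l ++ close :: D))) [] [] [])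
      (2 * passTime l.length N) := by
  have h := runs_forList (body := seq (emitRev .c .u) (emitRev .c .g)) hx hsx hN id
    (fun pre => (encodeNums pre).reverse) (T := 10 * N + 8) rfl (by omega) le_rfl hN
    (fun pre m rest hm => ((runs_emitRev_c m).seq (runs_emitRev_g _ _ m)).congr rfl
      (by simp [encodeNums_append]) (by omega))
  refine (h.seq ((runs_push_scratch hx close).seq (runs_move_g hx _))).congr rfl ?_ ?_
  · simp
  · have := length_encodeNums_le_passTime hN
    simp only [List.length_reverse]
    omega

/-- Append the list in front of the stack `x` to the list below it. -/
def mergeLists (x : Reg) : Prog :=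
  seq (forList x (emitRev .c .g)) (seq (popCase x fun _ => skip) (move .g x))

theorem runs_mergeLists (hx : x ∉ scratch) (hsx : s x = encodeNums l ++ close :: D)
    (hN : ∀ m ∈ l, m ≤ N) :
    Runs (mergeLists x) (withScratch s [] [] []) (withScratch (Function.update s x
      (encodeNums l ++ D)) [] [] []) (2 * passTime l.length N) := by
  have h := runs_forList (body := emitRev .c .g) hx hsx hN (fun _ => [])
    (fun pre => (encodeNums pre).reverse) (T := 10 * N + 8) rfl (by omega) (by simp) (by simp)
    (fun pre m rest hm => (runs_emitRev_g _ _ m).congr rfl (by simp [encodeNums_append])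
      (by omega))
  have h₂ : Runs (popCase x fun _ => skip)
      (withScratch (Function.update s x (encodeNums [] ++ close :: D)) [] []
        (encodeNums l).reverse)
      (withScratch (Function.update s x D) [] [] (encodeNums l).reverse) 2 := by
    refine (Runs.popCase (Runs.skip _)).congr rfl ?_ le_rfl
    simp only [update_withScratch_of_notMem hx, withScratch_of_notMem hx, Function.update_idem,
      Function.update_self]
    rfl
  refine (h.seq (h₂.seq (runs_move_g hx _))).congr rfl ?_ ?_
  · simp
  · have := length_encodeNums_le_passTime hN
    have : 2 * l.length + 7 ≤ passTime l.length N := by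
      unfold passTime
      nlinarith
    simp only [List.length_reverse]
    omega

/-- Add the number on the stack `y` to the list in front of the stack `x`. -/
def pushNum (y x : Reg) : Prog :=
  seq (emit y x) (push x .join)

theorem runs_pushNum (hyx : y ≠ x) (hx : x ∉ scratch) (hy : y ∉ scratch) (hsy : s y = ones n) :
    Runs (pushNum y x) (withScratch s [] [] [])
      (withScratch (Function.update s x (encodeNums [n] ++ s x)) [] [] []) (5 * n + 4) := by
  refine ((runs_emit_scratch hyx hy hx hsy).seq (runs_push_scratch hx _)).congr rfl ?_ (by omega)
  simp [encodeNums]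

theorem runs_readNum_of_notMem (hxy : x ≠ y) (hx : x ∉ scratch) (hy : y ∉ scratch)
    {c u : List ExprSymbol} (hsx : s x = encodeNat n ++ D) (hsy : s y = []) :
    Runs (readNum x y) (withScratch s c u g)
      (withScratch (Function.update (Function.update s x D) y (ones n)) c u g) (2 * n + 1) := by
  refine (runs_readNum (n := n) (l := D) hxy ?_ ?_).congr rfl ?_ le_rfl
  · rwa [withScratch_of_notMem hx]
  · rwa [withScratch_of_notMem hy]
  · rw [update_withScratch_of_notMem hx, update_withScratch_of_notMem hy]

theorem runs_drain_of_notMem (hx : x ∉ scratch) {c u : List ExprSymbol} (hsx : s x = D) :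
    Runs (drain x) (withScratch s c u g) (withScratch (Function.update s x []) c u g)
      (2 * D.length + 1) := by
  refine (runs_drain x _).congr rfl ?_ ?_
  · rw [update_withScratch_of_notMem hx]
  · rw [withScratch_of_notMem hx, hsx]

end Prog

/-! ### Normalization on the machine. -/

namespace Prog

/-- The stacks with given contents of those that are not for temporary use. -/
def config (inp mid d r f out a b kk : List ExprSymbol) : Reg → List ExprSymbol
  | .inp => inp
  | .mid => mid
  | .d => d
  | .r => r
  | .f => f
  | .out => out
  | .a => a
  | .b => b
  | .kk => kk
  | _ => []

section

variable (inp mid d r f out a b kk l : List ExprSymbol)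

theorem update_config_inp : Function.update (config inp mid d r f out a b kk) .inp l =
    config l mid d r f out a b kk := by
  funext z; cases z <;> rfl

theorem update_config_mid : Function.update (config inp mid d r f out a b kk) .mid l =
    config inp l d r f out a b kk := by
  funext z; cases z <;> rfl

theorem update_config_d : Function.update (config inp mid d r f out a b kk) .d l =
    config inp mid l r f out a b kk := by
  funext z; cases z <;> rfl

theorem update_config_r : Function.update (config inp mid d r f out a b kk) .r l =
    config inp mid d l f out a b kk := by
  funext z; cases z <;> rfl

theorem update_config_f : Function.update (config inp mid d r f out a b kk) .f l =
    config inp mid d r l out a b kk := by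
  funext z; cases z <;> rfl

theorem update_config_out : Function.update (config inp mid d r f out a b kk) .out l =
    config inp mid d r f l a b kk := by
  funext z; cases z <;> rfl

theorem update_config_a : Function.update (config inp mid d r f out a b kk) .a l =
    config inp mid d r f out l b kk := by
  funext z; cases z <;> rfl

theorem update_config_b : Function.update (config inp mid d r f out a b kk) .b l =
    config inp mid d r f out a l kk := by
  funext z; cases z <;> rfl

theorem update_config_kk : Function.update (config inp mid d r f out a b kk) .kk l =
    config inp mid d r f out a b l := by
  funext z; cases z <;> rfl

end

/-- Read two numbers from the stack `x`. -/
def readTwo (x : Reg) : Prog :=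
  seq (readNum x .a) (readNum x .b)

/-- Remove the two numbers that have been read. -/
def drainTwo : Prog :=
  seq (drain .a) (drain .b)

/-- Write an operation with the argument on the stack `a`. -/
def writeUnary (v : ExprSymbol) : Prog :=
  seq (emit .a .mid) (push .mid v)

/-- Write an operation with the arguments on the stacks `a` and `b`. -/
def writeBinary (v : ExprSymbol) : Prog :=
  seq (emit .b .mid) (seq (emit .a .mid) (push .mid v))

/-- Reading one operation while normalizing an expression. The stack `d` holds the lists of labels
to be fused for the subexpression in front and for all right operands that are still to be read. -/
def normalizeStep : Option ExprSymbol → Prog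
  | some .intro => seq (readNum .inp .a) (seq (ifMem .d .a skip (writeUnary .fuse))
      (seq (writeUnary .intro) (seq (dropList .d) (drain .a))))
  | some .union => seq (dupList .d) (push .mid .union)
  | some .join => seq (readTwo .inp) (seq (writeBinary .join) drainTwo)
  | some .relabel => seq (readTwo .inp)
      (seq (ifMem .d .b (seq (removeAll .d .a) (pushNum .a .d)) (removeAll .d .a))
        (seq (writeBinary .relabel) drainTwo))
  | some .fuse => seq (readNum .inp .a)
      (seq (ifMem .d .a skip (seq (pushNum .a .d) (writeUnary .fuse))) (drain .a))
  | _ => skip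

/-- Normalize the expression on the stack `inp` and write it, in reverse, to the stack `mid`. -/
def normalizeAll : Prog :=
  loop .inp Option.isSome normalizeStep

variable {inp mid d r f out kk D : List ExprSymbol} {i j k L : ℕ} {l : List ℕ}

theorem runs_writeUnary (v : ExprSymbol) :
    Runs (writeUnary v) (withScratch (config inp mid d r f out (ones i) [] kk) [] [] [])
      (withScratch (config inp (v :: (encodeNat i ++ mid)) d r f out (ones i) [] kk) [] [] [])
      (5 * i + 4) := by
  refine ((runs_emit_scratch (n := i) (by decide) (by decide) (by decide) rfl).seq
    (runs_push_scratch (by decide) v)).congr rfl ?_ (by omega)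
  simp only [update_config_mid, config]

theorem runs_writeBinary (v : ExprSymbol) :
    Runs (writeBinary v)
      (withScratch (config inp mid d r f out (ones i) (ones j) kk) [] [] [])
      (withScratch (config inp (v :: (encodeNat i ++ (encodeNat j ++ mid))) d r f out (ones i)
        (ones j) kk) [] [] []) (5 * i + 5 * j + 7) := by
  refine ((runs_emit_scratch (n := j) (by decide) (by decide) (by decide) rfl).seq
    ((runs_emit_scratch (n := i) (by decide) (by decide) (by decide) ?_).seq
    (runs_push_scratch (by decide) v))).congr rfl ?_ (by omega)
  · rw [update_config_mid]; rfl
  · simp only [update_config_mid, config]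

theorem passTime_mono {m m' N : ℕ} (h : m ≤ m') : passTime m N ≤ passTime m' N :=
  Nat.mul_le_mul_right _ (by omega)

theorem mul_le_passTime (m N : ℕ) : 40 * (N + 1) ≤ passTime m N :=
  Nat.le_mul_of_pos_left _ (by omega)

theorem runs_normalizeStep_intro (hi : i ≤ k) (hl : ∀ m ∈ l, m ≤ k) (hL : l.length ≤ L) :
    Runs (normalizeStep (some .intro))
      (withScratch (config (encodeNat i ++ inp) mid (encodeNums l ++ close :: D) r f out [] [] kk)
        [] [] [])
      (withScratch (config inp (.intro :: (encodeNat i ++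
        if i ∈ l then mid else .fuse :: (encodeNat i ++ mid))) D r f out [] [] kk) [] [] [])
      (5 * passTime L k) := by
  have hP := mul_le_passTime L k
  have hPl := passTime_mono (N := k) hL
  have h₁ := runs_readNum_of_notMem (x := .inp) (y := .a)
    (s := config (encodeNat i ++ inp) mid (encodeNums l ++ close :: D) r f out [] [] kk) (n := i)
    (g := []) (c := []) (u := []) (by decide) (by decide) (by decide) rfl rfl
  rw [update_config_inp, update_config_a] at h₁
  have h₂ : Runs (ifMem .d .a skip (writeUnary .fuse)) (withScratch (config inp mid
      (encodeNums l ++ close :: D) r f out (ones i) [] kk) [] [] [])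
      (withScratch (config inp (if i ∈ l then mid else .fuse :: (encodeNat i ++ mid))
      (encodeNums l ++ close :: D) r f out (ones i) [] kk) [] [] [])
      (5 * i + 4 + passTime l.length k) := by
    refine runs_ifMem (n := i) (by decide) (by decide) (by decide) rfl rfl hi hl ?_
    split_ifs
    · exact (Runs.skip _).mono (by omega)
    · exact runs_writeUnary _
  have h₃ := h₂.seq ((runs_writeUnary .intro).seq
    ((runs_dropList (x := .d) (by decide) rfl hl).seq
      (runs_drain_of_notMem (x := .a) (D := ones i) (by decide) rfl)))
  refine (h₁.seq h₃).congr rfl ?_ ?_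
  · simp only [update_config_d, update_config_a]
  · simp only [List.length_replicate]
    omega

theorem runs_normalizeStep_union (hl : ∀ m ∈ l, m ≤ k) (hL : l.length ≤ L) :
    Runs (normalizeStep (some .union))
      (withScratch (config inp mid (encodeNums l ++ close :: D) r f out [] [] kk) [] [] [])
      (withScratch (config inp (.union :: mid)
        (encodeNums l ++ close :: (encodeNums l ++ close :: D)) r f out [] [] kk) [] [] [])
      (5 * passTime L k) := by
  have hP := mul_le_passTime L k
  have hPl := passTime_mono (N := k) hL
  refine ((runs_dupList (x := .d) (by decide) rfl hl).seq
    (runs_push_scratch (by decide) .union)).congr rfl ?_ (by omega)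
  simp only [update_config_d, update_config_mid]
  rfl

theorem runs_readTwo_inp :
    Runs (readTwo .inp)
      (withScratch (config (encodeNat i ++ (encodeNat j ++ inp)) mid d r f out [] [] kk) [] [] [])
      (withScratch (config inp mid d r f out (ones i) (ones j) kk) [] [] [])
      (2 * i + 2 * j + 2) := by
  have h₁ := runs_readNum_of_notMem (x := .inp) (y := .a)
    (s := config (encodeNat i ++ (encodeNat j ++ inp)) mid d r f out [] [] kk) (n := i)
    (g := []) (c := []) (u := []) (by decide) (by decide) (by decide) rfl rfl
  rw [update_config_inp, update_config_a] at h₁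
  refine (h₁.seq (runs_readNum_of_notMem (n := j) (by decide) (by decide) (by decide) rfl
    rfl)).congr rfl ?_ (by omega)
  rw [update_config_inp, update_config_b]

theorem runs_drainTwo :
    Runs drainTwo (withScratch (config inp mid d r f out (ones i) (ones j) kk) [] [] [])
      (withScratch (config inp mid d r f out [] [] kk) [] [] []) (2 * i + 2 * j + 2) := by
  refine ((runs_drain_of_notMem (x := .a) (D := ones i) (by decide) rfl).seq
    (runs_drain_of_notMem (x := .b) (D := ones j) (by decide) rfl)).congr rfl ?_ ?_
  · rw [update_config_a, update_config_b]
  · simp only [List.length_replicate]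
    omega

theorem runs_normalizeStep_join (hi : i ≤ k) (hj : j ≤ k) :
    Runs (normalizeStep (some .join))
      (withScratch (config (encodeNat i ++ (encodeNat j ++ inp)) mid d r f out [] [] kk) [] [] [])
      (withScratch (config inp (.join :: (encodeNat i ++ (encodeNat j ++ mid))) d r f out [] [] kk)
        [] [] [])
      (5 * passTime L k) := by
  have hP := mul_le_passTime L k
  exact (runs_readTwo_inp.seq ((runs_writeBinary .join).seq runs_drainTwo)).mono (by omega)

theorem runs_normalizeStep_relabel (hi : i ≤ k) (hj : j ≤ k) (hl : ∀ m ∈ l, m ≤ k)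
    (hL : l.length ≤ L) :
    Runs (normalizeStep (some .relabel))
      (withScratch (config (encodeNat i ++ (encodeNat j ++ inp)) mid (encodeNums l ++ close :: D)
        r f out [] [] kk) [] [] [])
      (withScratch (config inp (.relabel :: (encodeNat i ++ (encodeNat j ++ mid)))
        (encodeNums (if j ∈ l then i :: l.filter (· ≠ i) else l.filter (· ≠ i)) ++ close :: D)
        r f out [] [] kk) [] [] [])
      (5 * passTime L k) := by
  have hP := mul_le_passTime L k
  have hPl := passTime_mono (N := k) hL
  have h₂ : Runs (ifMem .d .b (seq (removeAll .d .a) (pushNum .a .d)) (removeAll .d .a))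
      (withScratch (config inp mid (encodeNums l ++ close :: D) r f out (ones i) (ones j) kk)
        [] [] [])
      (withScratch (config inp mid
        (encodeNums (if j ∈ l then i :: l.filter (· ≠ i) else l.filter (· ≠ i)) ++ close :: D)
        r f out (ones i) (ones j) kk) [] [] [])
      (passTime l.length k + (5 * i + 4) + passTime l.length k) := by
    refine runs_ifMem (n := j) (by decide) (by decide) (by decide) rfl rfl hj hl ?_
    have h := runs_removeAll (x := .d) (y := .a) (n := i) (s := config inp mid
      (encodeNums l ++ close :: D) r f out (ones i) (ones j) kk) (by decide) (by decide)
      (by decide) rfl rfl hi hl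
    rw [update_config_d] at h
    split_ifs
    · refine (h.seq (runs_pushNum (n := i) (by decide) (by decide) (by decide) rfl)).congr rfl ?_
        le_rfl
      rw [update_config_d]
      simp [config, encodeNums]
    · exact h.mono (by omega)
  exact (runs_readTwo_inp.seq (h₂.seq ((runs_writeBinary .relabel).seq runs_drainTwo))).mono
    (by omega)

theorem runs_normalizeStep_fuse (hi : i ≤ k) (hl : ∀ m ∈ l, m ≤ k) (hL : l.length ≤ L) :
    Runs (normalizeStep (some .fuse))
      (withScratch (config (encodeNat i ++ inp) mid (encodeNums l ++ close :: D)
        r f out [] [] kk) [] [] [])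
      (withScratch (config inp (if i ∈ l then mid else .fuse :: (encodeNat i ++ mid))
        (encodeNums (if i ∈ l then l else i :: l) ++ close :: D) r f out [] [] kk) [] [] [])
      (5 * passTime L k) := by
  have hP := mul_le_passTime L k
  have hPl := passTime_mono (N := k) hL
  have h₁ := runs_readNum_of_notMem (x := .inp) (y := .a)
    (s := config (encodeNat i ++ inp) mid (encodeNums l ++ close :: D) r f out [] [] kk) (n := i)
    (g := []) (c := []) (u := []) (by decide) (by decide) (by decide) rfl rfl
  rw [update_config_inp, update_config_a] at h₁
  have h₂ : Runs (ifMem .d .a skip (seq (pushNum .a .d) (writeUnary .fuse)))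
      (withScratch (config inp mid (encodeNums l ++ close :: D) r f out (ones i) [] kk) [] [] [])
      (withScratch (config inp (if i ∈ l then mid else .fuse :: (encodeNat i ++ mid))
        (encodeNums (if i ∈ l then l else i :: l) ++ close :: D) r f out (ones i) [] kk) [] [] [])
      (5 * i + 4 + (5 * i + 4) + passTime l.length k) := by
    refine runs_ifMem (n := i) (by decide) (by decide) (by decide) rfl rfl hi hl ?_
    split_ifs
    · exact (Runs.skip _).mono (by omega)
    · have h := runs_pushNum (y := .a) (x := .d) (n := i) (s := config inp mid
        (encodeNums l ++ close :: D) r f out (ones i) [] kk) (by decide) (by decide) (by decide) rfl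
      rw [update_config_d] at h
      refine (h.seq (runs_writeUnary _)).congr rfl ?_ le_rfl
      simp [config, encodeNums]
  refine (h₁.seq (h₂.seq
    (runs_drain_of_notMem (x := .a) (D := ones i) (by decide) rfl))).congr rfl ?_ ?_
  · rw [update_config_a]
  · simp only [List.length_replicate]
    omega

/-- Peels off one iteration, so that a run can be built by prepending operations to the run on the
remaining input. -/
theorem runs_loop_cons_inp {p : Option ExprSymbol → Prog} {v : ExprSymbol} {a b : List ExprSymbol}
    {s₂ s₃ : Reg → List ExprSymbol} {t₁ t₂ : ℕ}
    (h₁ : Runs (p (some v)) (withScratch (config inp mid d r f out a b kk) [] [] []) s₂ t₁)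
    (h₂ : Runs (loop .inp Option.isSome p) s₂ s₃ t₂) :
    Runs (loop .inp Option.isSome p)
      (withScratch (config (v :: inp) mid d r f out a b kk) [] [] []) s₃ (t₁ + 1 + t₂) := by
  refine (Runs.loop_step (t₁ := t₁) (t₂ := t₂) rfl (h₁.congr ?_ rfl le_rfl) h₂).mono (by omega)
  rw [update_withScratch_of_notMem (by decide), update_config_inp]
  rfl

/-- The operations of an expression in reverse order, each followed by its labels. -/
def _root_.FuseExpr.encodeRev {k : ℕ} : FuseExpr k → List ExprSymbol
  | .intro i => .intro :: encodeNat i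
  | .union a b => b.encodeRev ++ (a.encodeRev ++ [.union])
  | .join i j a => a.encodeRev ++ .join :: (encodeNat i ++ encodeNat j)
  | .relabel i j a => a.encodeRev ++ .relabel :: (encodeNat i ++ encodeNat j)
  | .fuse i a => a.encodeRev ++ .fuse :: encodeNat i

theorem map_val_relabelPreimage {k : ℕ} (i j : Fin k) (S : List (Fin k)) :
    (FuseExpr.relabelPreimage i j S).map Fin.val =
      if j.val ∈ S.map Fin.val then i.val :: (S.map Fin.val).filter (· ≠ i.val)
      else (S.map Fin.val).filter (· ≠ i.val) := by
  have h : (S.filter (· ≠ i)).map Fin.val = (S.map Fin.val).filter (· ≠ i.val) := by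
    rw [List.filter_map]
    congr 1
    apply List.filter_congr
    simp [Fin.ext_iff]
  simp only [FuseExpr.relabelPreimage, List.mem_map_of_injective Fin.val_injective]
  split_ifs
  · rw [List.map_cons, h]
  · exact h

theorem length_relabelPreimage_le {k : ℕ} (i j : Fin k) (S : List (Fin k)) :
    (FuseExpr.relabelPreimage i j S).length ≤ S.length + 1 := by
  have := List.length_filter_le (· ≠ i) S
  rw [FuseExpr.relabelPreimage]
  split_ifs
  · simpa using this
  · omega

/-- Stated with an arbitrary continuation `h`, because the loop does not know where a subexpression
ends; processing `φ` consumes exactly the topmost list on `d`. An operation lengthens that list by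
at most one label, so `S.length + φ.size` bounds all lengths that arise. -/
theorem runs_normalizeAll_append {k : ℕ} (φ : FuseExpr k) (S : List (Fin k))
    (hL : S.length + φ.size ≤ L) {s' : Reg → List ExprSymbol} {t : ℕ}
    (h : Runs normalizeAll (withScratch (config inp ((FuseExpr.normalize S φ).encodeRev ++ mid) D
      r f out [] [] kk) [] [] []) s' t) :
    Runs normalizeAll (withScratch (config (φ.encode ++ inp) mid
      (encodeNums (S.map Fin.val) ++ close :: D) r f out [] [] kk) [] [] []) s'
      (φ.size * (5 * passTime L k + 1) + t) := by
  have hS : ∀ (S : List (Fin k)), ∀ m ∈ S.map Fin.val, m ≤ k := by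
    intro S m hm
    obtain ⟨x, -, rfl⟩ := List.mem_map.1 hm
    exact x.2.le
  have hmem : ∀ (S : List (Fin k)) (i : Fin k), i.val ∈ S.map Fin.val ↔ i ∈ S :=
    fun S i => List.mem_map_of_injective Fin.val_injective
  induction φ generalizing S inp mid D t with
  | intro i =>
    rw [FuseExpr.size] at hL ⊢
    rw [Nat.one_mul]
    refine runs_loop_cons_inp (runs_normalizeStep_intro (L := L) i.2.le (hS S)
      (by simp only [List.length_map]; omega)) ?_
    refine h.congr ?_ rfl le_rfl
    rw [FuseExpr.normalize]
    simp only [hmem]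
    split_ifs <;> simp [FuseExpr.encodeRev]
  | union a b iha ihb =>
    rw [FuseExpr.size] at hL ⊢
    rw [FuseExpr.normalize, FuseExpr.encodeRev] at h
    simp only [List.append_assoc, List.cons_append, List.nil_append] at h
    have h' := runs_loop_cons_inp (runs_normalizeStep_union (L := L) (mid := mid) (D := D) (hS S)
      (by simp only [List.length_map]; omega)) (iha S (by omega) (ihb S (by omega) h))
    refine h'.congr (by simp [FuseExpr.encode]) rfl ?_
    simp only [Nat.add_mul]
    omega
  | join i j a ih =>
    rw [FuseExpr.size] at hL ⊢
    rw [FuseExpr.normalize, FuseExpr.encodeRev] at h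
    simp only [List.append_assoc, List.cons_append] at h
    have h' := runs_loop_cons_inp (runs_normalizeStep_join (L := L) (mid := mid) i.2.le j.2.le)
      (ih S (by omega) h)
    refine h'.congr (by simp [FuseExpr.encode]) rfl ?_
    simp only [Nat.add_mul]
    omega
  | relabel i j a ih =>
    rw [FuseExpr.size] at hL ⊢
    rw [FuseExpr.normalize, FuseExpr.encodeRev] at h
    simp only [List.append_assoc, List.cons_append] at h
    have hlen := length_relabelPreimage_le i j S
    have h' := runs_loop_cons_inp (runs_normalizeStep_relabel (L := L) (mid := mid) (D := D)
      i.2.le j.2.le (hS S) (by simp only [List.length_map]; omega))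
      ((ih (FuseExpr.relabelPreimage i j S) (by omega) h).congr
          (by rw [map_val_relabelPreimage]) rfl le_rfl)
    refine h'.congr (by simp [FuseExpr.encode]) rfl ?_
    simp only [Nat.add_mul]
    omega
  | fuse i a ih =>
    rw [FuseExpr.size] at hL ⊢
    have h' := fun s' t h => runs_loop_cons_inp (s₃ := s') (t₂ := t) (runs_normalizeStep_fuse
      (i := i.val) (inp := a.encode ++ inp)
      (L := L) (mid := mid) (D := D) (r := r) (f := f) (out := out) (kk := kk) i.2.le (hS S)
      (by simp only [List.length_map]; omega)) h
    rw [FuseExpr.normalize] at h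
    simp only [hmem] at h'
    split_ifs at h h' with hi
    · refine (h' _ _ (ih S (by omega) h)).congr (by simp [FuseExpr.encode]) rfl ?_
      simp only [Nat.add_mul]
      omega
    · rw [FuseExpr.encodeRev] at h
      simp only [List.append_assoc, List.cons_append] at h
      refine (h' _ _ (ih (i :: S) (by simp only [List.length_cons]; omega) h)).congr
        (by simp [FuseExpr.encode]) rfl ?_
      simp only [Nat.add_mul]
      omega

end Prog

/-! ### Translation on the machine. -/

namespace Prog

/-- Write the numbers on the given stacks. -/
def emitAll : List Reg → Prog
  | [] => skip
  | y :: ys => seq (emitAll ys) (emit y .out)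

/-- Write a relabeling, given by stacks that hold labels. -/
def outRelabel (x : Reg) (ys : List Reg) : Prog :=
  seq (push .out close) (seq (emitAll ys) (seq (emit x .out) (push .out .relabel)))

/-- Write a join, given by stacks that hold labels. -/
def outJoin (x y : Reg) : Prog :=
  seq (emit y .out) (seq (emit x .out) (push .out .join))

section

variable {s : Reg → List ExprSymbol} {n : Reg → ℕ} {N : ℕ}

theorem runs_emitAll {ys : List Reg} (hs : s .t = [])
    (hy : ∀ y ∈ ys, y ≠ .out ∧ y ≠ .t ∧ s y = ones (n y) ∧ n y ≤ N) :
    Runs (emitAll ys) s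
      (Function.update s .out (ys.flatMap (fun y => encodeNat (n y)) ++ s .out))
      (ys.length * (5 * N + 3) + 1) := by
  induction ys with
  | nil => exact (Runs.skip s).congr rfl (by simp) (by simp)
  | cons y ys ih =>
    obtain ⟨h₁, h₂, h₃, h₄⟩ := hy y List.mem_cons_self
    refine ((ih fun z hz => hy z (List.mem_cons_of_mem _ hz)).seq
      (runs_emit (n := n y) h₁ h₂ (by decide) ?_ ?_)).congr rfl ?_ ?_
    · rwa [Function.update_of_ne h₁]
    · rwa [Function.update_of_ne (by decide)]
    · simp
    · simp only [List.length_cons, Nat.add_mul]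
      omega

theorem runs_outRelabel {x : Reg} {ys : List Reg} (hs : s .t = [])
    (hy : ∀ y ∈ x :: ys, y ≠ .out ∧ y ≠ .t ∧ s y = ones (n y) ∧ n y ≤ N) :
    Runs (outRelabel x ys) s
      (Function.update s .out (.relabel :: (encodeNat (n x) ++
        (ys.flatMap (fun y => encodeNat (n y)) ++ close :: s .out))))
      ((ys.length + 1) * (5 * N + 3) + 3) := by
  obtain ⟨h₁, h₂, h₃, h₄⟩ := hy x List.mem_cons_self
  refine ((Runs.push Reg.out close s).seq ((runs_emitAll (n := n) (N := N) ?_ ?_).seq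
    ((runs_emit (n := n x) h₁ h₂ (by decide) ?_ ?_).seq (Runs.push Reg.out .relabel _)))).congr rfl
    ?_ ?_
  · rwa [Function.update_of_ne (by decide)]
  · intro y hy'
    obtain ⟨g₁, g₂, g₃, g₄⟩ := hy y (List.mem_cons_of_mem _ hy')
    exact ⟨g₁, g₂, by rwa [Function.update_of_ne g₁], g₄⟩
  · rwa [Function.update_of_ne h₁, Function.update_of_ne h₁]
  · rwa [Function.update_of_ne (by decide), Function.update_of_ne (by decide)]
  · simp
  · simp only [Nat.add_mul]
    omega

theorem runs_outJoin {x y : Reg} (hs : s .t = [])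
    (hx : x ≠ .out ∧ x ≠ .t ∧ s x = ones (n x) ∧ n x ≤ N)
    (hy : y ≠ .out ∧ y ≠ .t ∧ s y = ones (n y) ∧ n y ≤ N) :
    Runs (outJoin x y) s
      (Function.update s .out (.join :: (encodeNat (n x) ++ (encodeNat (n y) ++ s .out))))
      (10 * N + 7) := by
  obtain ⟨h₁, h₂, h₃, h₄⟩ := hx
  obtain ⟨g₁, g₂, g₃, g₄⟩ := hy
  refine ((runs_emit (n := n y) g₁ g₂ (by decide) g₃ hs).seq
    ((runs_emit (n := n x) h₁ h₂ (by decide) ?_ ?_).seq (Runs.push Reg.out .join _))).congr rfl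
    ?_ ?_
  · rwa [Function.update_of_ne h₁]
  · rwa [Function.update_of_ne (by decide)]
  · simp
  · omega

end

/-- Run the program if the part of the output in front is not empty. -/
def ifNonempty (p : Prog) : Prog :=
  popCase .f fun
    | some .one => seq (push .f one) p
    | _ => push .f sep

/-- Treat one pending pair when the label on the stack `a` is fused. -/
def releasePair : Prog :=
  seq (readNum .r .c) (seq (popCase .r fun _ => skip) (seq (readNum .r .b)
    (seq (ifEq .a .c (outRelabel .kk [.kk, .b])
      (ifEq .a .b (outRelabel .kk [.kk, .c]) (seq (emitRev .c .u) (emitRev .b .u))))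
    (seq (drain .c) (drain .b)))))

/-- Reading one operation while translating a normalized expression. The stacks `r` and `f` hold
the pending pairs and the information whether there is an output, for all operands. -/
def translateStep : Option ExprSymbol → Prog
  | some .intro => seq (readNum .mid .a) (seq (push .r close) (seq (pushNum .a .r)
      (seq (pushNum .a .r) (seq (push .f sep) (drain .a)))))
  | some .union => seq (mergeLists .r) (popCase .f fun o => popCase .f fun o' =>
      match o, o' with
      | some .one, some .one => seq (push .out .union) (push .f one)
      | some .one, _ => push .f one
      | _, some .one => push .f one
      | _, _ => push .f sep)
  | some .join => seq (readTwo .mid)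
      (seq (ifMem .r .a
        (ifMem .r .b (seq (pushNum .b .r) (pushNum .a .r)) (ifNonempty (outRelabel .b [.b, .a])))
        (ifMem .r .b (ifNonempty (outRelabel .a [.a, .b])) (ifNonempty (outJoin .a .b))))
      drainTwo)
  | some .relabel => seq (readTwo .mid) (seq (replaceAll .r .a .b)
      (seq (ifNonempty (outRelabel .a [.b])) drainTwo))
  | some .fuse => seq (readNum .mid .a) (seq (push .out close) (seq (emit .kk .out)
      (seq (push .out .intro) (seq (popCase .f fun
        | some .one => seq (push .out .union) (push .f one)
        | _ => push .f one)
      (seq (outJoin .kk .a) (seq (outRelabel .a []) (seq (forEntries .r releasePair)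
        (seq (outRelabel .kk [.a]) (drain .a)))))))))
  | _ => skip

/-- Translate the normalized expression on the stack `mid`. -/
def translateAll : Prog :=
  loop .mid Option.isSome translateStep

/-- The symbol that tells whether an expression exists. -/
def flag {k : ℕ} : Option (MultiExpr k) → ExprSymbol
  | some _ => one
  | none => sep

/-- The encoding of an expression that may be missing. -/
def encodeOption {k : ℕ} : Option (MultiExpr k) → List ExprSymbol
  | some e => e.encode
  | none => []

/-- The encoding of a list of pairs of labels. -/
def encodePairs {k : ℕ} (I : List (Fin k × Fin k)) : List ExprSymbol :=
  encodeNums ((FuseExpr.entries I).map Fin.val)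

section

variable {k : ℕ} {mid r f out : List ExprSymbol} {i j : Fin k} {I : List (Fin k × Fin k)}
  {o : Option (MultiExpr (k + 1))} {L : ℕ}

/-- The stacks while a normalized expression is translated. -/
def transState (k : ℕ) (mid r f out a b : List ExprSymbol) : Reg → List ExprSymbol :=
  withScratch (config [] mid [] r f out a b (ones k)) [] [] []

theorem encodePairs_eq (I : List (Fin k × Fin k)) : encodePairs I =
    I.flatMap fun p => .join :: (encodeNat p.1 ++ .join :: encodeNat p.2) := by
  induction I with
  | nil => rfl
  | cons p I ih =>
    rw [List.flatMap_cons, ← ih]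
    simp [encodePairs, FuseExpr.entries, encodeNums]

theorem le_of_mem_entries : ∀ m ∈ (FuseExpr.entries I).map Fin.val, m ≤ k := by
  intro m hm
  obtain ⟨x, -, rfl⟩ := List.mem_map.1 hm
  exact x.2.le

theorem length_entries (I : List (Fin k × Fin k)) :
    (FuseExpr.entries I).length = 2 * I.length := by
  induction I with
  | nil => rfl
  | cons p I ih =>
    simp only [FuseExpr.entries, List.flatMap_cons, List.length_append, List.length_cons,
      List.length_nil] at ih ⊢
    omega

theorem val_mem_entries : i.val ∈ (FuseExpr.entries I).map Fin.val ↔ i ∈ FuseExpr.entries I :=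
  List.mem_map_of_injective Fin.val_injective

theorem runs_readTwo_mid {i j : ℕ} : Runs (readTwo .mid)
    (transState k (encodeNat i ++ (encodeNat j ++ mid)) r f out [] [])
    (transState k mid r f out (ones i) (ones j)) (2 * i + 2 * j + 2) := by
  have h₁ := runs_readNum_of_notMem (x := .mid) (y := .a)
    (s := config [] (encodeNat i ++ (encodeNat j ++ mid)) [] r f out [] [] (ones k)) (n := i)
    (g := []) (c := []) (u := []) (by decide) (by decide) (by decide) rfl rfl
  rw [update_config_mid, update_config_a] at h₁
  refine (h₁.seq (runs_readNum_of_notMem (n := j) (by decide) (by decide) (by decide) rfl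
    rfl)).congr rfl ?_ (by omega)
  rw [update_config_mid, update_config_b]
  rfl

theorem runs_readOne_mid {i : ℕ} : Runs (readNum .mid .a)
    (transState k (encodeNat i ++ mid) r f out [] [])
    (transState k mid r f out (ones i) []) (2 * i + 1) := by
  refine (runs_readNum_of_notMem (x := .mid) (y := .a)
    (s := config [] (encodeNat i ++ mid) [] r f out [] [] (ones k)) (n := i)
    (g := []) (c := []) (u := []) (by decide) (by decide) (by decide) rfl rfl).congr rfl ?_ le_rfl
  rw [update_config_mid, update_config_a]
  rfl

theorem runs_drainOne {i : ℕ} : Runs (drain .a) (transState k mid r f out (ones i) [])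
    (transState k mid r f out [] []) (2 * i + 1) := by
  refine (runs_drain_of_notMem (x := .a) (D := ones i) (by decide) rfl).congr rfl ?_ (by simp)
  rw [update_config_a]
  rfl

theorem update_transState_out {a b l : List ExprSymbol} :
    Function.update (transState k mid r f out a b) .out l = transState k mid r f l a b := by
  rw [transState, update_withScratch_of_notMem (by decide), update_config_out]
  rfl

theorem update_transState_f {a b l : List ExprSymbol} :
    Function.update (transState k mid r f out a b) .f l = transState k mid r l out a b := by
  rw [transState, update_withScratch_of_notMem (by decide), update_config_f]
  rfl

theorem update_transState_r {a b l : List ExprSymbol} :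
    Function.update (transState k mid r f out a b) .r l = transState k mid l f out a b := by
  rw [transState, update_withScratch_of_notMem (by decide), update_config_r]
  rfl

theorem update_transState_mid {a b l : List ExprSymbol} :
    Function.update (transState k mid r f out a b) .mid l = transState k l r f out a b := by
  rw [transState, update_withScratch_of_notMem (by decide), update_config_mid]
  rfl

/-- An operation is written only if there is an expression to apply it to; the flag, popped for the
test, is put back. -/
theorem runs_ifNonempty {p : Prog} {a b : List ExprSymbol} {s' : Reg → List ExprSymbol} {T : ℕ}
    (h : ∀ e, o = some e → Runs p (transState k mid r (flag o :: f) out a b) s' T)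
    (h' : o = none → transState k mid r (flag o :: f) out a b = s') :
    Runs (ifNonempty p) (transState k mid r (flag o :: f) out a b) s' (T + 2) := by
  refine Runs.popCase (t := T + 1) ?_
  cases o with
  | none =>
    refine (Runs.push Reg.f sep _).congr rfl ?_ (by omega)
    rw [← h' rfl, update_transState_f, update_transState_f]
    rfl
  | some e =>
    refine ((Runs.push Reg.f one _).seq ((h e rfl).congr ?_ rfl le_rfl)).mono (by omega)
    rw [update_transState_f, update_transState_f]
    rfl

end

end Prog

namespace Prog

section

variable {k : ℕ} {mid r f out : List ExprSymbol} {i j : Fin k} {I J : List (Fin k × Fin k)}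
  {o o' : Option (MultiExpr (k + 1))} {L : ℕ}

theorem runs_translateStep_intro :
    Runs (translateStep (some .intro)) (transState k (encodeNat i ++ mid) r f out [] [])
      (transState k mid (encodePairs [(i, i)] ++ close :: r) (sep :: f) out [] [])
      (7 * passTime L k) := by
  have hP := mul_le_passTime L k
  have hi := i.2
  have h₁ := Runs.push Reg.r close (transState k mid r f out (ones i) [])
  rw [update_transState_r] at h₁
  have h₂ : ∀ r, Runs (pushNum .a .r) (transState k mid r f out (ones i) [])
      (transState k mid (encodeNums [i.val] ++ r) f out (ones i) []) (5 * i + 4) := fun r =>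
    (runs_pushNum (n := i) (by decide) (by decide) (by decide) rfl).congr rfl
      (by rw [update_config_r]; rfl) le_rfl
  have h₃ := fun r => Runs.push Reg.f sep (transState k mid r f out (ones i) [])
  simp only [update_transState_f] at h₃
  refine (runs_readOne_mid.seq (h₁.seq ((h₂ _).seq ((h₂ _).seq ((h₃ _).seq
    runs_drainOne))))).congr rfl ?_ (by omega)
  simp only [encodePairs, FuseExpr.entries, List.flatMap_cons, List.flatMap_nil, List.append_nil,
    List.map_cons, List.map_nil, ← List.append_assoc, ← encodeNums_append]
  rfl

/-- The union of expressions that may be missing. -/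
def unionOption : Option (MultiExpr (k + 1)) → Option (MultiExpr (k + 1)) →
    Option (MultiExpr (k + 1))
  | some x, some y => some (.union x y)
  | some x, none => some x
  | none, y => y

/-- The right operand has been translated before the left one, so the left one lies on top on all
three stacks. One pushed symbol therefore completes the prefix notation of the union. -/
theorem runs_translateStep_union (hL : (FuseExpr.entries I).length ≤ L) :
    Runs (translateStep (some .union))
      (transState k mid (encodePairs I ++ close :: (encodePairs J ++ close :: r))
        (flag o :: flag o' :: f) (encodeOption o ++ (encodeOption o' ++ out)) [] [])
      (transState k mid (encodePairs (I ++ J) ++ close :: r) (flag (unionOption o o') :: f)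
        (encodeOption (unionOption o o') ++ out) [] [])
      (7 * passTime L k) := by
  have hP := mul_le_passTime L k
  have hPl := passTime_mono (N := k) hL
  have h₁ := runs_mergeLists (x := .r)
    (s := config [] mid [] (encodePairs I ++ close :: (encodePairs J ++ close :: r))
      (flag o :: flag o' :: f) (encodeOption o ++ (encodeOption o' ++ out)) [] [] (ones k))
      (by decide) rfl (le_of_mem_entries (I := I))
  rw [update_config_r, List.length_map] at h₁
  refine (h₁.seq (t₂ := 4) (Runs.popCase (t := 3) (Runs.popCase (t := 2)
    (s' := transState k mid (encodePairs (I ++ J) ++ close :: r) (flag (unionOption o o') :: f)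
      (encodeOption (unionOption o o') ++ out) [] []) ?_))).mono (by omega)
  have e : encodeNums ((FuseExpr.entries I).map Fin.val) ++ (encodePairs J ++ close :: r) =
      encodePairs (I ++ J) ++ close :: r := by
    simp [encodePairs, FuseExpr.entries, encodeNums]
  rw [e]
  have hf : ∀ v out, Runs (push Reg.f v) (transState k mid (encodePairs (I ++ J) ++ close :: r) f
      out [] []) (transState k mid (encodePairs (I ++ J) ++ close :: r) (v :: f) out [] []) 2 :=
    fun v out => (Runs.push Reg.f v _).congr rfl (by rw [update_transState_f]; rfl) (by omega)
  have hs : Function.update (Function.update (withScratch (config [] mid []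
      (encodePairs (I ++ J) ++ close :: r) (flag o :: flag o' :: f)
      (encodeOption o ++ (encodeOption o' ++ out)) [] [] (ones k)) [] [] []) .f (flag o' :: f)) .f f
      = transState k mid (encodePairs (I ++ J) ++ close :: r) f
      (encodeOption o ++ (encodeOption o' ++ out)) [] [] := by
    rw [Function.update_idem, ← transState, update_transState_f]
  cases o <;> cases o'
  · exact (hf sep _).congr hs.symm rfl le_rfl
  · exact (hf one _).congr hs.symm rfl le_rfl
  · exact (hf one _).congr hs.symm rfl le_rfl
  · refine ((Runs.push Reg.out .union _).seq (Runs.push Reg.f one _)).congr hs.symm ?_ le_rfl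
    rw [update_transState_out, update_transState_f]
    simp only [unionOption, encodeOption, MultiExpr.encode, List.cons_append, List.append_assoc]
    rfl

/-- The numbers on the stacks that hold labels. -/
def labelOf (k i j c : ℕ) : Reg → ℕ
  | .a => i
  | .b => j
  | .c => c
  | .kk => k
  | _ => 0

theorem runs_drainTwo_trans {i j : ℕ} : Runs drainTwo
    (transState k mid r f out (ones i) (ones j)) (transState k mid r f out [] [])
    (2 * i + 2 * j + 2) :=
  runs_drainTwo

theorem runs_ifMem_trans {p q : Prog} {x : Reg} {n : ℕ} {a b : List ExprSymbol}
    {s' : Reg → List ExprSymbol} {T : ℕ} (hx : x = .a ∨ x = .b) (hn : n ≤ k)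
    (hsx : transState k mid (encodePairs I ++ close :: r) f out a b x = ones n)
    (hL : (FuseExpr.entries I).length ≤ L)
    (h : Runs (if n ∈ (FuseExpr.entries I).map Fin.val then p else q)
      (transState k mid (encodePairs I ++ close :: r) f out a b) s' T) :
    Runs (ifMem .r x p q) (transState k mid (encodePairs I ++ close :: r) f out a b) s'
      (T + passTime L k) := by
  have hPl := passTime_mono (N := k) hL
  rcases hx with rfl | rfl
  · exact (runs_ifMem (x := .r) (y := .a) (n := n) (l := (FuseExpr.entries I).map Fin.val)
      (s := config [] mid [] (encodePairs I ++ close :: r) f out a b (ones k)) (by decide)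
      (by decide) (by decide) rfl hsx hn le_of_mem_entries h).mono
      (by rw [List.length_map]; omega)
  · exact (runs_ifMem (x := .r) (y := .b) (n := n) (l := (FuseExpr.entries I).map Fin.val)
      (s := config [] mid [] (encodePairs I ++ close :: r) f out a b (ones k)) (by decide)
      (by decide) (by decide) rfl hsx hn le_of_mem_entries h).mono
      (by rw [List.length_map]; omega)

theorem runs_translateStep_join (hL : (FuseExpr.entries I).length ≤ L) :
    Runs (translateStep (some .join))
      (transState k (encodeNat i ++ (encodeNat j ++ mid)) (encodePairs I ++ close :: r)
        (flag o :: f) (encodeOption o ++ out) [] [])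
      (transState k mid (encodePairs (if i ∈ FuseExpr.entries I ∧ j ∈ FuseExpr.entries I then
          (i, j) :: I else I) ++ close :: r)
        (flag o :: f) (encodeOption (o.map fun e =>
          if i ∈ FuseExpr.entries I then
            if j ∈ FuseExpr.entries I then e
            else .relabel (castSucc j) [castSucc j, castSucc i] e
          else if j ∈ FuseExpr.entries I then .relabel (castSucc i) [castSucc i, castSucc j] e
          else .join (castSucc i) (castSucc j) e) ++ out) [] [])
      (7 * passTime L k) := by
  have hP := mul_le_passTime L k
  have hi := i.2
  have hj := j.2
  have key : ∀ s', Runs (if i.val ∈ (FuseExpr.entries I).map Fin.val then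
      (ifMem .r .b (seq (pushNum .b .r) (pushNum .a .r)) (ifNonempty (outRelabel .b [.b, .a])))
      else (ifMem .r .b (ifNonempty (outRelabel .a [.a, .b])) (ifNonempty (outJoin .a .b))))
      (transState k mid (encodePairs I ++ close :: r) (flag o :: f) (encodeOption o ++ out)
        (ones i) (ones j)) s' (15 * k + 14 + passTime L k) →
      Runs (ifMem .r .a
        (ifMem .r .b (seq (pushNum .b .r) (pushNum .a .r)) (ifNonempty (outRelabel .b [.b, .a])))
        (ifMem .r .b (ifNonempty (outRelabel .a [.a, .b])) (ifNonempty (outJoin .a .b))))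
      (transState k mid (encodePairs I ++ close :: r) (flag o :: f) (encodeOption o ++ out)
        (ones i) (ones j)) s' (15 * k + 14 + passTime L k + passTime L k) := fun s' h =>
    runs_ifMem_trans (Or.inl rfl) hi.le rfl hL h
  refine ((runs_readTwo_mid (i := i) (j := j)).seq ((key _ ?_).seq
    (runs_drainTwo_trans (i := i) (j := j)))).mono (by omega)
  simp only [val_mem_entries]
  by_cases h₁ : i ∈ FuseExpr.entries I <;> by_cases h₂ : j ∈ FuseExpr.entries I
  · simp only [h₁, h₂, and_self, if_true, Option.map_id']
    refine runs_ifMem_trans (Or.inr rfl) hj.le rfl hL ?_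
    simp only [val_mem_entries, h₂, if_true]
    refine ((runs_pushNum (n := j) (by decide) (by decide) (by decide) rfl).seq
      (runs_pushNum (n := i) (by decide) (by decide) (by decide) rfl)).congr rfl ?_ (by omega)
    rw [update_config_r, update_config_r]
    simp [encodePairs, FuseExpr.entries, encodeNums, config, transState]
  · simp only [h₁, h₂, and_false, if_true, if_false]
    refine runs_ifMem_trans (Or.inr rfl) hj.le rfl hL ?_
    simp only [val_mem_entries, h₂, if_false]
    refine runs_ifNonempty (T := 15 * k + 12) ?_ ?_
    · rintro e rfl
      refine (runs_outRelabel (n := labelOf k i j 0) (N := k) rfl ?_).congr rfl ?_ ?_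
      · simp [labelOf, transState, withScratch, config, hi.le, hj.le]
      · rw [update_transState_out]
        simp [MultiExpr.encode, encodeLabels, encodeOption, labelOf, transState, withScratch,
          config]
      · simp only [List.length_cons, List.length_nil]
        omega
    · rintro rfl
      rfl
  · simp only [h₁, h₂, false_and, if_true, if_false]
    refine runs_ifMem_trans (Or.inr rfl) hj.le rfl hL ?_
    simp only [val_mem_entries, h₂, if_true]
    refine runs_ifNonempty (T := 15 * k + 12) ?_ ?_
    · rintro e rfl
      refine (runs_outRelabel (n := labelOf k i j 0) (N := k) rfl ?_).congr rfl ?_ ?_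
      · simp [labelOf, transState, withScratch, config, hi.le, hj.le]
      · rw [update_transState_out]
        simp [MultiExpr.encode, encodeLabels, encodeOption, labelOf, transState, withScratch,
          config]
      · simp only [List.length_cons, List.length_nil]
        omega
    · rintro rfl
      rfl
  · simp only [h₁, h₂, and_false, if_false]
    refine runs_ifMem_trans (Or.inr rfl) hj.le rfl hL ?_
    simp only [val_mem_entries, h₂, if_false]
    refine runs_ifNonempty (T := 15 * k + 12) ?_ ?_
    · rintro e rfl
      refine (runs_outJoin (n := labelOf k i j 0) (N := k) rfl ?_ ?_).congr rfl ?_ ?_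
      · simp [labelOf, transState, withScratch, config, hi.le]
      · simp [labelOf, transState, withScratch, config, hj.le]
      · rw [update_transState_out]
        simp [MultiExpr.encode, encodeOption, labelOf, transState, withScratch, config]
      · omega
    · rintro rfl
      rfl

theorem map_val_entries_map (i j : Fin k) (I : List (Fin k × Fin k)) :
    (FuseExpr.entries (I.map (Prod.map (fun x => if x = i then j else x)
      (fun x => if x = i then j else x)))).map Fin.val =
      ((FuseExpr.entries I).map Fin.val).map fun m => if m = i.val then j.val else m := by
  induction I with
  | nil => rfl
  | cons p I ih =>
    have h : ∀ x : Fin k, (if x = i then j else x).val =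
        if x.val = i.val then j.val else x.val := by
      intro x
      rw [apply_ite Fin.val]
      simp only [Fin.ext_iff]
    simp only [FuseExpr.entries, List.map_cons, List.flatMap_cons, List.map_append,
      List.map_nil, Prod.map_fst, Prod.map_snd, h] at ih ⊢
    rw [ih]

theorem runs_translateStep_relabel (hL : (FuseExpr.entries I).length ≤ L) :
    Runs (translateStep (some .relabel))
      (transState k (encodeNat i ++ (encodeNat j ++ mid)) (encodePairs I ++ close :: r)
        (flag o :: f) (encodeOption o ++ out) [] [])
      (transState k mid (encodePairs (I.map (Prod.map (fun x => if x = i then j else x)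
          (fun x => if x = i then j else x))) ++ close :: r)
        (flag o :: f) (encodeOption (o.map (.relabel (castSucc i) [castSucc j])) ++ out) [] [])
      (7 * passTime L k) := by
  have hP := mul_le_passTime L k
  have hPl := passTime_mono (N := k) hL
  have hi := i.2
  have hj := j.2
  have h₁ := runs_replaceAll (x := .r) (y := .a) (z := .b) (n := i) (n' := j) (s := config [] mid []
      (encodePairs I ++ close :: r) (flag o :: f) (encodeOption o ++ out) (ones i) (ones j)
      (ones k)) (by decide) (by decide) (by decide) (by decide) (by decide) rfl rfl rfl hi.le hj.le
      le_of_mem_entries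
  have e : encodeNums (((FuseExpr.entries I).map Fin.val).map
      fun m => if m = i.val then j.val else m) = encodePairs (I.map (Prod.map
        (fun x => if x = i then j else x) (fun x => if x = i then j else x))) := by
    rw [encodePairs, map_val_entries_map]
  rw [update_config_r, e, List.length_map] at h₁
  refine ((runs_readTwo_mid (i := i) (j := j)).seq (h₁.seq
    ((runs_ifNonempty (T := 10 * k + 9) ?_ ?_).seq
      (runs_drainTwo_trans (i := i) (j := j))))).mono (by omega)
  · rintro e rfl
    refine (runs_outRelabel (n := labelOf k i j 0) (N := k) rfl ?_).congr rfl ?_ ?_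
    · simp [labelOf, transState, withScratch, config, hi.le, hj.le]
    · rw [update_transState_out]
      simp [MultiExpr.encode, encodeLabels, encodeOption, labelOf, transState, withScratch,
        config]
    · simp only [List.length_cons, List.length_nil]
      omega
  · rintro rfl
    rfl

end

end Prog

/-- The machine handles the pairs from the front, each one wrapping the output so far; this is the
matching recursion. -/
theorem FuseExpr.addPartners_concat {k : ℕ} (i : Fin k) (I : List (Fin k × Fin k))
    (p : Fin k × Fin k) (e : MultiExpr (k + 1)) :
    addPartners i (I ++ [p]) e = addPartners i [p] (addPartners i I e) := by
  induction I generalizing e with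
  | nil => rfl
  | cons q I ih => exact ih _

namespace Prog

section

variable {k : ℕ} {mid r f out : List ExprSymbol} {i j : Fin k} {I J : List (Fin k × Fin k)}
  {o o' : Option (MultiExpr (k + 1))} {L : ℕ}

theorem runs_releasePair {u : List ExprSymbol} (i : Fin k) (p : Fin k × Fin k)
    (e : MultiExpr (k + 1)) :
    Runs releasePair
      (withScratch (config [] mid [] (encodeNat p.1 ++ .join :: encodeNat p.2 ++ r) f
        (e.encode ++ out) (ones i) [] (ones k)) [] u [])
      (withScratch (config [] mid [] r f ((FuseExpr.addPartners i [p] e).encode ++ out)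
        (ones i) [] (ones k)) []
        ((encodePairs ([p].filter fun p => p.1 ≠ i ∧ p.2 ≠ i)).reverse ++ u) [])
      (43 * k + 40) := by
  obtain ⟨p, q⟩ := p
  have hi := i.2
  have hp := p.2
  have hq := q.2
  have h₁ := runs_readNum_scratch (x := .r) (n := p) (u := u) (g := [])
    (l := .join :: encodeNat q ++ r) (s := config [] mid []
    (encodeNat p ++ .join :: encodeNat q ++ r) f (e.encode ++ out) (ones i) [] (ones k)) (by decide)
    (by simp [config])
  rw [update_config_r] at h₁
  have h₂ : Runs (popCase .r fun _ => skip)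
      (withScratch (config [] mid [] (.join :: encodeNat q ++ r) f (e.encode ++ out) (ones i) []
        (ones k)) (ones p) u [])
      (withScratch (config [] mid [] (encodeNat q ++ r) f (e.encode ++ out) (ones i) []
        (ones k)) (ones p) u []) 2 := by
    refine (Runs.popCase (Runs.skip _)).congr rfl ?_ le_rfl
    rw [update_withScratch_of_notMem (by decide), update_config_r]
    rfl
  have h₃ := runs_readNum_of_notMem (x := .r) (y := .b) (n := q) (c := ones p) (u := u) (g := [])
    (s := config [] mid [] (encodeNat q ++ r) f (e.encode ++ out) (ones i) [] (ones k))
    (by decide) (by decide) (by decide) rfl rfl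
  rw [update_config_r, update_config_b] at h₃
  refine (h₁.seq (h₂.seq (h₃.seq ((runs_ifEq_c (n := i) (T := 25 * k + 22)
    (s' := withScratch (config [] mid [] r f ((FuseExpr.addPartners i [(p, q)] e).encode ++ out)
        (ones i) (ones q) (ones k)) (ones p)
        ((encodePairs ([(p, q)].filter fun p => p.1 ≠ i ∧ p.2 ≠ i)).reverse ++ u) [])
    (by decide) rfl ?_).seq
    (runs_drain_scratch.seq (runs_drain_of_notMem (x := .b) (D := ones q) (by decide)
      rfl)))))).congr rfl ?_ ?_
  · by_cases hpi : p = i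
    · rw [if_pos (by rw [hpi])]
      refine (runs_outRelabel (n := labelOf k i q p) (N := k) rfl ?_).congr rfl ?_ ?_
      · simp [labelOf, withScratch, config, hq.le]
      · rw [update_withScratch_of_notMem (by decide), update_config_out]
        simp [FuseExpr.addPartners, hpi, MultiExpr.encode, encodeLabels, labelOf, withScratch,
          config, encodePairs, FuseExpr.entries, encodeNums]
      · simp only [List.length_cons, List.length_nil]
        omega
    · rw [if_neg (fun h => hpi (Fin.ext h.symm))]
      refine (runs_ifEq_scratch (n := i) (m := q) (T := 15 * k + 12) (by decide) (by decide)
        (by decide) rfl rfl ?_).mono (by omega)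
      by_cases hqi : q = i
      · rw [if_pos (by rw [hqi])]
        refine (runs_outRelabel (n := labelOf k i q p) (N := k) rfl ?_).congr rfl ?_ ?_
        · simp [labelOf, withScratch, config, hp.le]
        · rw [update_withScratch_of_notMem (by decide), update_config_out]
          simp [FuseExpr.addPartners, hpi, hqi, MultiExpr.encode, encodeLabels, labelOf,
            withScratch, config, encodePairs, FuseExpr.entries, encodeNums]
        · simp only [List.length_cons, List.length_nil]
          omega
      · rw [if_neg (fun h => hqi (Fin.ext h.symm))]
        refine ((runs_emitRev_c p).seq (runs_emitRev_scratch (n := q) (by decide) rfl)).congr rfl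
          ?_ (by omega)
        simp [FuseExpr.addPartners, hpi, hqi, encodePairs, FuseExpr.entries, encodeNums]
  · rw [update_config_b]
  · simp only [List.length_replicate]
    omega

theorem runs_releaseAll (i : Fin k) (e : MultiExpr (k + 1))
    (hL : (FuseExpr.entries I).length ≤ L) :
    Runs (forEntries .r releasePair)
      (transState k mid (encodePairs I ++ close :: r) f (e.encode ++ out) (ones i) [])
      (transState k mid (encodePairs (I.filter fun p => p.1 ≠ i ∧ p.2 ≠ i) ++ close :: r) f
        ((FuseExpr.addPartners i I e).encode ++ out) (ones i) [])
      (passTime L k) := by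
  have h := runs_forEntries (x := .r) (body := releasePair) (by decide)
    (fun p : Fin k × Fin k => encodeNat p.1 ++ .join :: encodeNat p.2)
    (fun pre => config [] mid [] [] f ((FuseExpr.addPartners i pre e).encode ++ out) (ones i) []
      (ones k))
    (fun pre => encodePairs (pre.filter fun p => p.1 ≠ i ∧ p.2 ≠ i)) (fun _ => []) I r
    (43 * k + 40) rfl (fun pre p post _ => by
      rw [update_config_r, update_config_r, FuseExpr.addPartners_concat]
      refine (runs_releasePair i p _).congr rfl ?_ le_rfl
      simp only [List.filter_append, encodePairs_eq, List.flatMap_append, List.reverse_append])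
  simp only [update_config_r] at h
  refine h.congr ?_ rfl ?_
  · rw [encodePairs_eq]
    rfl
  · have h₁ : (encodePairs (I.filter fun p => p.1 ≠ i ∧ p.2 ≠ i)).length ≤
        2 * I.length * (k + 2) := by
      refine (length_encodeNums_le le_of_mem_entries).trans (Nat.mul_le_mul_right _ ?_)
      rw [List.length_map, length_entries]
      have := List.length_filter_le (fun p : Fin k × Fin k => decide (p.1 ≠ i ∧ p.2 ≠ i)) I
      omega
    refine le_trans ?_ (passTime_mono hL)
    rw [length_entries]
    unfold passTime
    nlinarith

theorem runs_translateStep_fuse (hL : (FuseExpr.entries I).length ≤ L) :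
    Runs (translateStep (some .fuse))
      (transState k (encodeNat i ++ mid) (encodePairs I ++ close :: r)
        (flag o :: f) (encodeOption o ++ out) [] [])
      (transState k mid (encodePairs (I.filter fun p => p.1 ≠ i ∧ p.2 ≠ i) ++ close :: r)
        (one :: f)
        ((MultiExpr.relabel (last k) [castSucc i] (FuseExpr.addPartners i I
          (.relabel (castSucc i) [] (.join (last k) (castSucc i)
            (match o with
              | some e => .union (.intro [last k]) e
              | none => .intro [last k]))))).encode ++ out) [] [])
      (7 * passTime L k) := by
  have hP := mul_le_passTime L k
  have hi := i.2
  -- The label `last k` has value `k`, so its unary code is the content of the stack `kk`.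
  set e₀ : MultiExpr (k + 1) := match o with
    | some e => .union (.intro [last k]) e
    | none => .intro [last k] with he₀
  set R := encodePairs I ++ close :: r with hR
  have h₁ : ∀ out v, Runs (push .out v) (transState k mid R (flag o :: f) out (ones i) [])
      (transState k mid R (flag o :: f) (v :: out) (ones i) []) 1 := fun out v =>
    (Runs.push Reg.out v _).congr rfl (by rw [update_transState_out]; rfl) le_rfl
  have h₂ : ∀ out, Runs (emit .kk .out) (transState k mid R (flag o :: f) out (ones i) [])
      (transState k mid R (flag o :: f) (encodeNat k ++ out) (ones i) []) (5 * k + 3) := fun out =>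
    (runs_emit (by decide) (by decide) (by decide) rfl rfl).congr rfl
      (by rw [update_transState_out]; rfl) le_rfl
  have h₃ : Runs (popCase .f fun
        | some ExprSymbol.one => seq (push .out .union) (push .f one)
        | _ => push .f one : Prog)
      (transState k mid R (flag o :: f)
        (.intro :: (encodeNat k ++ close :: (encodeOption o ++ out))) (ones i) [])
      (transState k mid R (one :: f) (e₀.encode ++ out) (ones i) []) 3 := by
    refine Runs.popCase (t := 2) ?_
    cases o with
    | none =>
      refine (Runs.push Reg.f one _).congr rfl ?_ (by omega)
      rw [update_transState_f, update_transState_f]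
      simp [he₀, MultiExpr.encode, encodeLabels, encodeOption, transState, withScratch, config,
        flag]
    | some e =>
      refine ((Runs.push Reg.out .union _).seq (Runs.push Reg.f one _)).congr rfl ?_ le_rfl
      rw [update_transState_f, update_transState_out, update_transState_f]
      simp [he₀, MultiExpr.encode, encodeLabels, encodeOption, transState, withScratch, config,
        flag]
  have h₄ : Runs (outJoin .kk .a) (transState k mid R (one :: f) (e₀.encode ++ out) (ones i) [])
      (transState k mid R (one :: f) ((MultiExpr.join (last k) (castSucc i) e₀).encode ++ out)
        (ones i) []) (10 * k + 7) := by
    refine (runs_outJoin (n := labelOf k i 0 0) (N := k) rfl ?_ ?_).congr rfl ?_ le_rfl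
    · simp [labelOf, transState, withScratch, config]
    · simp [labelOf, transState, withScratch, config, hi.le]
    · rw [update_transState_out]
      simp [MultiExpr.encode, labelOf, transState, withScratch, config]
  have h₅ : Runs (outRelabel .a []) (transState k mid R (one :: f)
        ((MultiExpr.join (last k) (castSucc i) e₀).encode ++ out) (ones i) [])
      (transState k mid R (one :: f)
        ((MultiExpr.relabel (castSucc i) [] (.join (last k) (castSucc i) e₀)).encode ++ out)
        (ones i) []) (5 * k + 6) := by
    refine (runs_outRelabel (n := labelOf k i 0 0) (N := k) rfl ?_).congr rfl ?_ ?_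
    · simp [labelOf, transState, withScratch, config, hi.le]
    · rw [update_transState_out]
      simp [MultiExpr.encode, encodeLabels, labelOf, transState, withScratch, config]
    · simp only [List.length_nil]
      omega
  have h₆ : ∀ R e, Runs (outRelabel .kk [.a])
      (transState k mid R (one :: f) (MultiExpr.encode e ++ out) (ones i) [])
      (transState k mid R (one :: f) ((MultiExpr.relabel (last k) [castSucc i] e).encode ++ out)
        (ones i) []) (10 * k + 9) := by
    intro R e
    refine (runs_outRelabel (n := labelOf k i 0 0) (N := k) rfl ?_).congr rfl ?_ ?_
    · simp [labelOf, transState, withScratch, config, hi.le]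
    · rw [update_transState_out]
      simp [MultiExpr.encode, encodeLabels, labelOf, transState, withScratch, config]
    · simp only [List.length_cons, List.length_nil]
      omega
  exact (runs_readOne_mid.seq ((h₁ _ _).seq ((h₂ _).seq ((h₁ _ _).seq (h₃.seq (h₄.seq (h₅.seq
    ((runs_releaseAll i _ hL).seq ((h₆ _ _).seq runs_drainOne))))))))).mono (by omega)

end

end Prog

/-! ### Size bounds. -/

namespace FuseExpr

variable {k : ℕ}

theorem length_pending_le (φ : FuseExpr k) : φ.pending.length ≤ φ.size := by
  induction φ with
  | intro i => simp [pending, size]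
  | union a b iha ihb =>
    rw [pending, size, List.length_append]
    omega
  | join i j a ih =>
    rw [pending, size]
    split_ifs
    · simpa using ih
    · omega
  | relabel i j a ih =>
    rw [pending, size, List.length_map]
    omega
  | fuse i a ih =>
    rw [pending, size]
    exact (List.length_filter_le _ _).trans (by omega)

/-- Only leaves can grow, each by one fuse node. -/
theorem size_normalize_le (S : List (Fin k)) (φ : FuseExpr k) :
    (normalize S φ).size ≤ 2 * φ.size := by
  induction φ generalizing S with
  | intro i =>
    rw [normalize]
    split_ifs <;> simp [size]
  | union a b iha ihb =>
    have h₁ := iha S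
    have h₂ := ihb S
    simp only [normalize, size]
    omega
  | join i j a ih =>
    have h₁ := ih S
    simp only [normalize, size]
    omega
  | relabel i j a ih =>
    have h₁ := ih (relabelPreimage i j S)
    simp only [normalize, size]
    omega
  | fuse i a ih =>
    have h₁ := ih S
    have h₂ := ih (i :: S)
    rw [normalize]
    split_ifs <;> simp only [size] <;> omega

end FuseExpr

/-! ### The complete program and its running time. -/

namespace Prog

section

variable {k L : ℕ} {mid r f out : List ExprSymbol}

theorem runs_loop_cons_mid {p : Option ExprSymbol → Prog} {v : ExprSymbol} {a b : List ExprSymbol}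
    {s₂ s₃ : Reg → List ExprSymbol} {t₁ t₂ : ℕ}
    (h₁ : Runs (p (some v)) (transState k mid r f out a b) s₂ t₁)
    (h₂ : Runs (loop .mid Option.isSome p) s₂ s₃ t₂) :
    Runs (loop .mid Option.isSome p) (transState k (v :: mid) r f out a b) s₃ (t₁ + 1 + t₂) := by
  refine (Runs.loop_step (t₁ := t₁) (t₂ := t₂) rfl (h₁.congr ?_ rfl le_rfl) h₂).mono (by omega)
  rw [update_transState_mid]
  rfl

theorem flag_map (g : MultiExpr (k + 1) → MultiExpr (k + 1)) (o : Option (MultiExpr (k + 1))) :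
    flag (o.map g) = flag o := by
  cases o <;> rfl

/-- Again with a continuation `h`. The factor 2 in `hL` arises since each pending pair is stored as
two numbers, and there are at most `φ.size` pairs. -/
theorem runs_translateAll_append (φ : FuseExpr k) (hL : 2 * φ.size ≤ L)
    {s' : Reg → List ExprSymbol} {t : ℕ}
    (h : Runs translateAll (transState k mid (encodePairs φ.pending ++ close :: r)
      (flag φ.toMulti :: f) (encodeOption φ.toMulti ++ out) [] []) s' t) :
    Runs translateAll (transState k (φ.encodeRev ++ mid) r f out [] []) s'
      (φ.size * (7 * passTime L k + 1) + t) := by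
  have hI : ∀ a : FuseExpr k, 2 * a.size ≤ L → (FuseExpr.entries a.pending).length ≤ L := by
    intro a ha
    have := a.length_pending_le
    rw [length_entries]
    omega
  induction φ generalizing mid r f out t with
  | intro i =>
    rw [FuseExpr.size, Nat.one_mul]
    exact runs_loop_cons_mid runs_translateStep_intro h
  | union a b iha ihb =>
    rw [FuseExpr.size] at hL ⊢
    have e : (a.union b).toMulti = unionOption a.toMulti b.toMulti := by
      rw [FuseExpr.toMulti]
      cases a.toMulti <;> cases b.toMulti <;> rfl
    rw [e, FuseExpr.pending] at h
    -- The reversed notation lists the right operand first.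
    have h' := ihb (by omega) (iha (by omega) (runs_loop_cons_mid
      (runs_translateStep_union (hI a (by omega))) h))
    refine h'.congr (by simp [FuseExpr.encodeRev]) rfl ?_
    simp only [Nat.add_mul]
    omega
  | join i j a ih =>
    rw [FuseExpr.size] at hL ⊢
    rw [FuseExpr.pending, FuseExpr.toMulti, flag_map] at h
    have h' := ih (by omega) (runs_loop_cons_mid
      (runs_translateStep_join (hI a (by omega))) h)
    refine h'.congr (by simp [FuseExpr.encodeRev]) rfl ?_
    simp only [Nat.add_mul]
    omega
  | relabel i j a ih =>
    rw [FuseExpr.size] at hL ⊢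
    rw [FuseExpr.pending, FuseExpr.toMulti, flag_map] at h
    have h' := ih (by omega) (runs_loop_cons_mid
      (runs_translateStep_relabel (hI a (by omega))) h)
    refine h'.congr (by simp [FuseExpr.encodeRev]) rfl ?_
    simp only [Nat.add_mul]
    omega
  | fuse i a ih =>
    rw [FuseExpr.size] at hL ⊢
    have h' := ih (by omega) (runs_loop_cons_mid (runs_translateStep_fuse (i := i) (mid := mid)
      (r := r) (f := f) (out := out) (hI a (by omega))) h)
    refine h'.congr (by simp [FuseExpr.encodeRev]) rfl ?_
    simp only [Nat.add_mul]
    omega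

/-- Translate a number `k` and a fuse-`k`-expression to a multi-`(k + 1)`-expression. -/
def translate : Prog :=
  seq (readNum .inp .kk) (seq (push .d close) (seq normalizeAll (seq translateAll
    (seq (drain .kk) (seq (drain .r) (drain .f))))))

/-- The summands are normalization, translation of an expression of size at most `2 * n`, and
clearing the stacks; `4 * n` bounds the lengths of all lists. -/
theorem cubic_bound (n k : ℕ) : n * (5 * passTime (4 * n) k + 1) +
    2 * n * (7 * passTime (4 * n) k + 1) + passTime (4 * n) k + 4 * k + 20 ≤
      4000 * (n + k + 1) ^ 3 := by
  unfold passTime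
  have h : n * (4 * n + 1) * (k + 1) ≤ 4 * (n + k + 1) ^ 3 := by
    calc n * (4 * n + 1) * (k + 1) ≤ (n + k + 1) * (4 * (n + k + 1)) * (n + k + 1) := by
          gcongr <;> omega
      _ = _ := by ring
  have h₁ : (4 * n + 1) * (k + 1) ≤ 4 * (n + k + 1) ^ 3 := by
    calc (4 * n + 1) * (k + 1) ≤ (4 * (n + k + 1)) * (n + k + 1) * (n + k + 1) := by
          rw [mul_assoc _ (n + k + 1)]
          gcongr
          · omega
          · nlinarith
      _ = _ := by ring
  have h₂ : n + k + 1 ≤ (n + k + 1) ^ 3 := Nat.le_self_pow (by omega) _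
  calc _ = 760 * (n * (4 * n + 1) * (k + 1)) + 40 * ((4 * n + 1) * (k + 1)) +
        (3 * n + 4 * k + 20) := by ring
    _ ≤ _ := by omega

/-- One unit of time is held back for the halting step of the machine. -/
theorem runs_translate (φ : FuseExpr k) {ψ : MultiExpr (k + 1)}
    (hψ : (FuseExpr.normalize [] φ).toMulti = some ψ) :
    Runs translate (Function.update (fun _ => []) .inp (encodeNat k ++ φ.encode))
      (Function.update (fun _ => []) .out ψ.encode) (4000 * (φ.size + k + 1) ^ 3 - 1) := by
  set χ := FuseExpr.normalize [] φ with hχ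
  have hsize : χ.size ≤ 2 * φ.size := FuseExpr.size_normalize_le [] φ
  have h₁ := runs_readNum_of_notMem (x := .inp) (y := .kk) (n := k) (c := []) (u := []) (g := [])
    (s := config (encodeNat k ++ φ.encode) [] [] [] [] [] [] [] []) (by decide) (by decide)
    (by decide) rfl rfl
  rw [update_config_inp, update_config_kk] at h₁
  have h₂ := runs_push_scratch (y := .d) (c := []) (u := []) (g := [])
    (s := config φ.encode [] [] [] [] [] [] [] (ones k)) (by decide) close
  rw [update_config_d] at h₂
  have h₃ : Runs normalizeAll
      (withScratch (config φ.encode [] [close] [] [] [] [] [] (ones k)) [] [] [])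
      (transState k χ.encodeRev [] [] [] [] [])
      (φ.size * (5 * passTime (4 * φ.size) k + 1) + 1) := by
    refine (runs_normalizeAll_append (inp := []) (mid := []) (D := []) (r := []) (f := [])
      (out := []) (kk := ones k) φ []
      (L := 4 * φ.size) (by simp only [List.length_nil]; omega)
      (Runs.loop_exit (by rfl))).congr (by simp [encodeNums]) ?_ le_rfl
    rw [update_withScratch_of_notMem (by decide), update_config_inp, List.append_nil]
    rfl
  have h₄ : Runs translateAll (transState k χ.encodeRev [] [] [] [] [])
      (transState k [] (encodePairs χ.pending ++ [close]) [one] ψ.encode [] [])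
      (χ.size * (7 * passTime (4 * φ.size) k + 1) + 1) := by
    refine (runs_translateAll_append (mid := []) (r := []) (f := []) (out := []) χ
      (L := 4 * φ.size) (by omega) (Runs.loop_exit (by rfl))).congr (by simp) ?_ le_rfl
    rw [update_transState_mid, hψ]
    simp [flag, encodeOption, transState, withScratch, config]
  have h₅ := (runs_drain_of_notMem (x := .kk) (c := []) (u := []) (g := []) (s := config [] [] []
    (encodePairs χ.pending ++ [close]) [one] ψ.encode [] [] (ones k)) (by decide) rfl).seq
    ((runs_drain_of_notMem (x := .r) (by decide) rfl).seq
      (runs_drain_of_notMem (x := .f) (by decide) rfl))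
  refine (h₁.seq (h₂.seq (h₃.seq (h₄.seq h₅)))).congr ?_ ?_ ?_
  · funext z
    cases z <;> rfl
  · rw [update_config_kk, update_config_r, update_config_f]
    funext z
    cases z <;> rfl
  · have hb := cubic_bound φ.size k
    have hp : 2 * (encodePairs χ.pending).length + 2 ≤ passTime (4 * φ.size) k := by
      refine (length_encodeNums_le_passTime le_of_mem_entries).trans (passTime_mono ?_)
      have := χ.length_pending_le
      rw [List.length_map, length_entries]
      omega
    have hm := Nat.mul_le_mul_right (7 * passTime (4 * φ.size) k + 1) hsize
    simp only [update_config_kk, update_config_r, config, List.length_append, List.length_cons,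
      List.length_nil, List.length_replicate]
    omega

end

end Prog

/-! ### The theorem. -/

theorem multiCliqueWidth_le_fusionWidth_add_one {V : Type u} (G : SimpleGraph V) :
    multiCliqueWidth G ≤ fusionWidth G + 1 := by
  unfold fusionWidth
  rw [ENat.iInf_add]
  refine le_iInf fun k => ?_
  rw [ENat.iInf_add]
  refine le_iInf fun ⟨φ, hφ⟩ => ?_
  obtain ⟨ψ, -, hψ⟩ := φ.exists_toMulti_isExprOf G hφ
  exact (iInf₂_le (k + 1) ⟨ψ, hψ⟩).trans (by simp)

theorem theorem1 :
    (∀ {V : Type u} (G : SimpleGraph V), multiCliqueWidth G ≤ fusionWidth G + 1) ∧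
    -- One machine, with one polynomial time bound, for all `k`, all graphs and all expressions:
    -- from `k` and a fuse-`k`-expression of `G` it computes a multi-`(k + 1)`-expression of `G`.
    ∃ (M : Turing.TM2ComputableAux ExprSymbol ExprSymbol) (p : Polynomial ℕ),
      (∀ s, Finite (M.tm.Γ s)) ∧
      ∀ (k : ℕ) (φ : FuseExpr k) {V : Type u} (G : SimpleGraph V), φ.IsExprOf G →
        ∃ ψ : MultiExpr (k + 1), ψ.IsExprOf G ∧
          Nonempty (Turing.TM2OutputsInTime M.tm
            ((encodeNat k ++ φ.encode).map M.inputAlphabet.symm)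
            (some (ψ.encode.map M.outputAlphabet.symm))
            (p.eval (φ.size + k))) := by
  refine ⟨fun G => multiCliqueWidth_le_fusionWidth_add_one G,
    ⟨Prog.translate.machine .inp .out, Equiv.refl _, Equiv.refl _⟩,
    4000 * (Polynomial.X + 1) ^ 3, fun _ => inferInstanceAs (Finite ExprSymbol), ?_⟩
  intro k φ V G hφ
  obtain ⟨ψ, hψ, hG⟩ := φ.exists_toMulti_isExprOf G hφ
  refine ⟨ψ, hG, ?_⟩
  have h := (Prog.runs_translate φ hψ).tm2OutputsInTime
  have e : 4000 * (φ.size + k + 1) ^ 3 - 1 + 1 =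
      (4000 * (Polynomial.X + 1) ^ 3 : Polynomial ℕ).eval (φ.size + k) := by
    -- Positivity makes the truncated subtraction of the halting step cancel.
    have : 0 < (φ.size + k + 1) ^ 3 := by positivity
    simp
    omega
  have hm : ∀ l : List ExprSymbol, l.map (Equiv.refl ExprSymbol).symm = l := List.map_id
  rw [e] at h
  exact (hm (encodeNat k ++ φ.encode)).symm ▸ (hm ψ.encode).symm ▸ h
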